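/- Let $(E,\|\cdot\|_E)$ be a real Banach space of Rademacher type $p\in[1,2]$, let $q\in[p,\infty)$, let $k,M\in\mathbb N$ be positive integers, and let $(\Omega,\mathcal A,\mathbb P)$ be a probability space. Let $\eta_1,\dots,\eta_M\in L_{kq}(\Omega;E)$ be independent (not necessarily identically distributed) $E$-valued random variables with vanishing injective $k$th moment, $\mathbb M^k_\varepsilon[\eta_j]=0$ for all $1\le j\le M$. Then $\sum_{j=1}^M\otimes^k\eta_j\in L_q(\Omega;\otimes^{k,s}_{\varepsilon_s}E)$ and $$ \Bigl\|\sum_{j=1}^M \otimes^k\eta_j\Bigr\|_{L_q(\Omega;\,\otimes^{k,s}_{\varepsilon_s}E)} \;\le\; 4k\,K_{q,p}\,\tau_p(E)\,\Bigl(\sum_{j=1}^M\|\eta_j\|_{L_{kq}(\Omega;E)}^{kp}\Bigr)^{1/p}. $$ Here the following notation is used. * For a real Banach space $F$ and $r\in[1,\infty)$, $L_r(\Omega;F)$ is the Bochner space of strongly measurable $\eta:\Omega\to F$ with $\|\eta\|_{L_r(\Omega;F)}=(\mathbb E\|\eta\|_F^r)^{1/r}<\infty$. The dual of $E$ is $E'$,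 with closed unit ball $B_{E'}$, and $\otimes^k x=x\otimes\cdots\otimes x$ ($k$ factors). * $\otimes^k_\varepsilon E$ is the completion of the $k$-fold algebraic tensor power of $E$ with respect to the injective norm $\|U\|_\varepsilon=\sup\{|\langle f_1\otimes\cdots\otimes f_k,U\rangle| : f_1,\dots,f_k\in B_{E'}\}$, and $\mathbb M^k_\varepsilon[\eta]=\mathbb E[\otimes^k\eta]$ is the Bochner integral in $\otimes^k_\varepsilon E$. * $\otimes^{k,s}_{\varepsilon_s}E$ is the completion of the linear span of $\{\otimes^k x: x\in E\}$ with respect to the symmetric injective norm $\bigl\|\sum_j\lambda_j\otimes^k x_j\bigr\|_{\varepsilon_s}=\sup\bigl\{\bigl|\sum_j\lambda_j f(x_j)^k\bigr| : f\in B_{E'}\bigr\}$. * A Rademacher family $(r_j)_{j\in\mathbb N}$ is a family of independent random variables on a complete probability space $(\widetilde\Omega,\widetilde{\mathcal A},\widetilde{\mathbb P})$ with $\widetilde{\mathbb P}(r_j=1)=\widetilde{\mathbb P}(r_j=-1)=\tfrac12$. * $K_{q,p}$, the Kahane–Khintchine constant, is the infimum of all $K\in(0,\infty)$ such that $\bigl\|\sum_{j=1}^n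 r_jx_j\bigr\|_{L_q(\widetilde\Omega;F)}\le K\bigl\|\sum_{j=1}^n r_jx_j\bigr\|_{L_p(\widetilde\Omega;F)}$ for all Rademacher families, all real Banach spaces $F$, all $n\in\mathbb N$ and all $x_1,\dots,x_n\in F$. * $E$ has Rademacher type $p\in[1,2]$ if there is $\tau\in(0,\infty)$ such that $\bigl\|\sum_{j=1}^n r_jx_j\bigr\|_{L_p(\widetilde\Omega;E)}\le\tau\bigl(\sum_{j=1}^n\|x_j\|_E^p\bigr)^{1/p}$ for all Rademacher families, all $n\in\mathbb N$ and all $x_1,\dots,x_n\in E$; the infimum of all such $\tau$ is the type $p$ constant $\tau_p(E)$. -/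

import Mathlib

open MeasureTheory ProbabilityTheory
open scoped TensorProduct ENNReal

universe u v

noncomputable section

namespace InjectiveMoments

/-! ### Rademacher families, Kahane–Khintchine constants, type -/

/-- A Rademacher family indexed by `ℕ` on a complete probability space: independent random
variables with values in `{-1, 1}`, each value being taken with probability `1 / 2`. -/
structure IsRademacherFamily {Ω : Type v} [MeasurableSpace Ω] (P : Measure Ω)
    (r : ℕ → Ω → ℝ) : Prop where
  isProbabilityMeasure : IsProbabilityMeasure P
  isComplete : P.IsComplete
  measurable : ∀ j, Measurable (r j)
  values : ∀ j ω, r j ω = 1 ∨ r j ω = -1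
  prob_one : ∀ j, P {ω | r j ω = 1} = 1 / 2
  prob_neg_one : ∀ j, P {ω | r j ω = -1} = 1 / 2
  indep : iIndepFun r P

/-- `K > 0` is admissible in the `(q, p)` Kahane–Khintchine inequality, for all Rademacher
families, all real Banach spaces `F` and all finite families of vectors of `F`. (Only the joint
law of finitely many signs and the finite-dimensional span of the vectors matter, so the choice of
universes is immaterial.) -/
def IsKahaneKhintchineBound (q p K : ℝ) : Prop :=
  0 < K ∧
  ∀ (Ω : Type) [MeasurableSpace Ω] (P : Measure Ω) (r : ℕ → Ω → ℝ), IsRademacherFamily P r →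
  ∀ (F : Type u) [NormedAddCommGroup F] [NormedSpace ℝ F] [CompleteSpace F]
    (n : ℕ) (x : Fin n → F),
    lpNorm (fun ω => ∑ j : Fin n, r j ω • x j) (ENNReal.ofReal q) P ≤
      K * lpNorm (fun ω => ∑ j : Fin n, r j ω • x j) (ENNReal.ofReal p) P

/-- The Kahane–Khintchine constant `K_{q,p}`. -/
def kahaneKhintchineConst (q p : ℝ) : ℝ := sInf {K : ℝ | IsKahaneKhintchineBound.{u} q p K}

section TypeConst

variable (F : Type u) [NormedAddCommGroup F] [NormedSpace ℝ F]

/-- `τ > 0` is admissible in the Rademacher type `p` inequality of `F`. -/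
def IsTypeBound (p τ : ℝ) : Prop :=
  0 < τ ∧
  ∀ (Ω : Type) [MeasurableSpace Ω] (P : Measure Ω) (r : ℕ → Ω → ℝ), IsRademacherFamily P r →
  ∀ (n : ℕ) (x : Fin n → F),
    lpNorm (fun ω => ∑ j : Fin n, r j ω • x j) (ENNReal.ofReal p) P ≤
      τ * (∑ j : Fin n, ‖x j‖ ^ p) ^ (1 / p)

/-- `F` has Rademacher type `p ∈ [1, 2]`. -/
def HasRademacherType (p : ℝ) : Prop :=
  p ∈ Set.Icc (1 : ℝ) 2 ∧ ∃ τ : ℝ, IsTypeBound F p τ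

/-- The type `p` constant `τ_p(F)`. -/
def typeConst (p : ℝ) : ℝ := sInf {τ : ℝ | IsTypeBound F p τ}

end TypeConst

/-! ### Suprema of pointwise bounded families of functionals are seminorms -/

theorem supCore {V ι : Type*} [AddCommGroup V] [Module ℝ V] [Nonempty ι] [Norm V]
    (φ : ι → V →ₗ[ℝ] ℝ) (hφ : ∀ x, BddAbove (Set.range fun i => |φ i x|))
    (hn : ∀ x : V, ‖x‖ = ⨆ i, |φ i x|) : SeminormedSpace.Core ℝ V where
  norm_nonneg x := by
    rw [hn]
    exact Real.iSup_nonneg fun i => abs_nonneg _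
  norm_smul c x := by
    rw [hn, hn, Real.norm_eq_abs, Real.mul_iSup_of_nonneg (abs_nonneg c)]
    simp [abs_mul]
  norm_triangle x y := by
    rw [hn, hn, hn]
    refine ciSup_le fun i => ?_
    rw [map_add]
    exact (abs_add_le _ _).trans (add_le_add (le_ciSup (hφ x) i) (le_ciSup (hφ y) i))

/-! ### Full and symmetric injective tensor powers -/

variable (k : ℕ) (E : Type u) [NormedAddCommGroup E] [NormedSpace ℝ E]

/-- The algebraic `k`-fold tensor power of `E`, to be equipped with the injective norm. -/
def AlgTensor : Type u := ⨂[ℝ] _ : Fin k, E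

instance : AddCommGroup (AlgTensor k E) := inferInstanceAs (AddCommGroup (⨂[ℝ] _ : Fin k, E))

instance : Module ℝ (AlgTensor k E) := inferInstanceAs (Module ℝ (⨂[ℝ] _ : Fin k, E))

variable {k E}

/-- The pure tensor `x₁ ⊗ ⋯ ⊗ x_k`. -/
def AlgTensor.pure (x : Fin k → E) : AlgTensor k E := PiTensorProduct.tprod ℝ x

/-- The functional `f₁ ⊗ ⋯ ⊗ f_k` on the algebraic tensor power. -/
def AlgTensor.eval (f : Fin k → StrongDual ℝ E) : AlgTensor k E →ₗ[ℝ] ℝ :=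
  PiTensorProduct.lift
    ((MultilinearMap.mkPiAlgebra ℝ (Fin k) ℝ).compLinearMap fun n => (f n).toLinearMap)

theorem AlgTensor.eval_pure (f : Fin k → StrongDual ℝ E) (x : Fin k → E) :
    AlgTensor.eval f (AlgTensor.pure x) = ∏ n, f n (x n) := by
  exact (PiTensorProduct.lift.tprod x).trans (by simp)

variable (k E)

/-- `k`-tuples of functionals in the closed unit ball of the dual of `E`. -/
abbrev DualBallTuple : Type u := Fin k → Metric.closedBall (0 : StrongDual ℝ E) 1

variable {k E}

theorem AlgTensor.bddAbove (U : AlgTensor k E) : ∃ C : ℝ, ∀ f : Fin k → StrongDual ℝ E,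
    (∀ n, ‖f n‖ ≤ 1) → |AlgTensor.eval f U| ≤ C := by
  refine PiTensorProduct.induction_on
    (motive := fun U : AlgTensor k E => ∃ C : ℝ, ∀ f : Fin k → StrongDual ℝ E,
      (∀ n, ‖f n‖ ≤ 1) → |AlgTensor.eval f U| ≤ C) U ?_ ?_
  · intro c x
    refine ⟨|c| * ∏ n, ‖x n‖, fun f hf => ?_⟩
    have h := AlgTensor.eval_pure f x
    have h2 : AlgTensor.eval f (c • AlgTensor.pure x) = c * ∏ n, f n (x n) := by
      rw [map_smul, h, smul_eq_mul]
    refine (congrArg abs h2).le.trans ?_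
    rw [abs_mul, Finset.abs_prod]
    refine mul_le_mul_of_nonneg_left ?_ (abs_nonneg c)
    refine Finset.prod_le_prod (fun _ _ => abs_nonneg _) fun n _ => ?_
    exact ((f n).le_opNorm (x n)).trans (mul_le_of_le_one_left (norm_nonneg _) (hf n))
  · rintro U V ⟨C, hC⟩ ⟨D, hD⟩
    refine ⟨C + D, fun f hf => ?_⟩
    have h : AlgTensor.eval f (U + V) = AlgTensor.eval f U + AlgTensor.eval f V :=
      map_add (AlgTensor.eval f) U V
    exact (congrArg abs h).le.trans
      ((abs_add_le _ _).trans (add_le_add (hC f hf) (hD f hf)))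

/-- The injective norm `‖U‖_ε = sup { |⟨f₁ ⊗ ⋯ ⊗ f_k, U⟩| : f₁, …, f_k ∈ B_{E'} }`. -/
instance : Norm (AlgTensor k E) :=
  ⟨fun U => ⨆ f : DualBallTuple k E, |AlgTensor.eval (fun n => (f n : StrongDual ℝ E)) U|⟩

theorem AlgTensor.core : SeminormedSpace.Core ℝ (AlgTensor k E) := by
  have : Nonempty (DualBallTuple k E) := ⟨fun _ => ⟨0, by simp⟩⟩
  refine supCore (fun f : DualBallTuple k E => AlgTensor.eval fun n => (f n : StrongDual ℝ E))
    (fun U => ?_) (fun U => rfl)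
  obtain ⟨C, hC⟩ := AlgTensor.bddAbove U
  refine ⟨C, ?_⟩
  rintro _ ⟨f, rfl⟩
  exact hC _ fun n => mem_closedBall_zero_iff.mp (f n).2

instance : SeminormedAddCommGroup (AlgTensor k E) :=
  SeminormedAddCommGroup.ofCore AlgTensor.core

instance : NormedSpace ℝ (AlgTensor k E) where
  norm_smul_le c U := (AlgTensor.core.norm_smul c U).le

variable (k E)

/-- The full `k`-fold injective tensor product of `E`: the completion of the algebraic tensor
power with respect to the injective norm. -/
abbrev InjTensor : Type u := UniformSpace.Completion (AlgTensor k E)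

/-- The algebraic symmetric tensor power: the span of the powers `x ⊗ ⋯ ⊗ x`. -/
def symSubmodule : Submodule ℝ (AlgTensor k E) :=
  Submodule.span ℝ (Set.range fun x : E => AlgTensor.pure fun _ : Fin k => x)

/-- The algebraic symmetric tensor power, to be equipped with the symmetric injective norm (and
not with the restriction of the full injective norm). -/
def SymAlgTensor : Type u := symSubmodule k E

instance : AddCommGroup (SymAlgTensor k E) := inferInstanceAs (AddCommGroup (symSubmodule k E))

instance : Module ℝ (SymAlgTensor k E) := inferInstanceAs (Module ℝ (symSubmodule k E))

/-- The inclusion of the symmetric algebraic tensor power in the full one. -/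
def SymAlgTensor.incl : SymAlgTensor k E →ₗ[ℝ] AlgTensor k E := (symSubmodule k E).subtype

variable {k E}

/-- The symmetric injective norm `‖U‖_{ε_s} = sup { |⟨f ⊗ ⋯ ⊗ f, U⟩| : f ∈ B_{E'} }`; for
`U = ∑ j, λ_j • (x_j ⊗ ⋯ ⊗ x_j)` one has `⟨f ⊗ ⋯ ⊗ f, U⟩ = ∑ j, λ_j * f (x_j) ^ k`. -/
instance : Norm (SymAlgTensor k E) :=
  ⟨fun U => ⨆ f : Metric.closedBall (0 : StrongDual ℝ E) 1,
    |AlgTensor.eval (fun _ => (f : StrongDual ℝ E)) (SymAlgTensor.incl k E U)|⟩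

theorem SymAlgTensor.core : SeminormedSpace.Core ℝ (SymAlgTensor k E) := by
  have : Nonempty (Metric.closedBall (0 : StrongDual ℝ E) 1) := ⟨⟨0, by simp⟩⟩
  refine supCore (fun f : Metric.closedBall (0 : StrongDual ℝ E) 1 =>
    (AlgTensor.eval fun _ => (f : StrongDual ℝ E)) ∘ₗ SymAlgTensor.incl k E)
    (fun U => ?_) (fun U => rfl)
  obtain ⟨C, hC⟩ := AlgTensor.bddAbove (SymAlgTensor.incl k E U)
  refine ⟨C, ?_⟩
  rintro _ ⟨f, rfl⟩
  exact hC _ fun n => mem_closedBall_zero_iff.mp f.2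

instance : SeminormedAddCommGroup (SymAlgTensor k E) :=
  SeminormedAddCommGroup.ofCore SymAlgTensor.core

instance : NormedSpace ℝ (SymAlgTensor k E) where
  norm_smul_le c U := (SymAlgTensor.core.norm_smul c U).le

variable (k E)

/-- The `k`-fold symmetric injective tensor product of `E`: the completion of the algebraic
symmetric tensor power with respect to the symmetric injective norm. -/
abbrev SymInjTensor : Type u := UniformSpace.Completion (SymAlgTensor k E)

variable {E}

/-- The power `⊗^k x` as an element of the full injective tensor product. -/
def tensorPow (x : E) : InjTensor k E := ((AlgTensor.pure fun _ => x : AlgTensor k E) : InjTensor k E)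

/-- The power `⊗^k x` as an element of the algebraic symmetric tensor power. -/
def algSymTensorPow (x : E) : SymAlgTensor k E :=
  (⟨AlgTensor.pure fun _ => x, Submodule.subset_span ⟨x, rfl⟩⟩ : symSubmodule k E)

/-- The power `⊗^k x` as an element of the symmetric injective tensor product. -/
def symTensorPow (x : E) : SymInjTensor k E := (algSymTensorPow k x : SymInjTensor k E)

/-- The injective `k`-th moment `𝕄^k_ε[ξ] = 𝔼[⊗^k ξ]`, a Bochner integral in the full injective
tensor product (which exists whenever `ξ ∈ L_k`). -/
def injMoment {Ω : Type v} [MeasurableSpace Ω] (P : Measure Ω) (ξ : Ω → E) : InjTensor k E :=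
  ∫ ω, tensorPow k (ξ ω) ∂P

end InjectiveMoments

end

namespace InjectiveMoments

/-! ### Averages over signs -/

/-! The powers `⊗^k η_j` are independent. They are also centred in the symmetric injective tensor
product: the functionals `f ⊗ ⋯ ⊗ f` separate its points, and each integrates `⊗^k η_j` to `𝔼
f(η_j)^k`, which the vanishing full injective moment makes zero. For centred independent summands,
conditional Jensen bounds the `L_q` norm of the sum by twice that of the sum with any fixed choice
of signs (`lpNorm_sum_le_two_mul_lpNorm_signed_sum`). Averaging over all sign vectors and fixing `ω`
leaves a deterministic question about a sign average of `‖∑ ε_j ⊗^k x_j‖^q`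
(`signMean_norm_symTensorPow_le`).

There Kahane–Khintchine lowers `q` to `p` at the cost of `K_{q,p}`. The symmetric norm is a supremum
over `f` of `|∑ ε_j f(x_j)^k|`, and on the range of `f ↦ f(x_j)` the `k`th power is Lipschitz with
constant `k‖x_j‖^(k-1)`. The Ledoux–Talagrand contraction principle (`signMean_iSup_contraction`)
therefore replaces `f(x_j)^k` by `k‖x_j‖^(k-1) f(x_j)`, with a further factor 2 for the absolute
value. What remains is a Rademacher sum in `E` of the vectors `‖x_j‖^(k-1) x_j`, to which type `p`
applies. Minkowski's inequality in `L_{q/p}` finishes the proof, and `4k = 2 · 2k`.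

The constants are infima, and a real infimum over the empty set is `0`, so an admissible
Kahane–Khintchine constant has to be exhibited. This is done by hypercontractivity on the sign cube.
-/

/-- The sign `±1` encoded by a Boolean. -/
def boolSign (b : Bool) : ℝ := cond b 1 (-1)

/-- The average of `g` over all sign vectors of length `n`. -/
noncomputable def signMean {n : ℕ} (g : (Fin n → ℝ) → ℝ) : ℝ :=
  (∑ ε : Fin n → Bool, g (fun j => boolSign (ε j))) / 2 ^ n

theorem signMean_zero (g : (Fin 0 → ℝ) → ℝ) : signMean g = g ![] := by
  simp [signMean, Subsingleton.elim (fun j : Fin 0 => boolSign _) ![]]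

theorem signMean_succ {n : ℕ} (g : (Fin (n + 1) → ℝ) → ℝ) :
    signMean g = (signMean (fun ε => g (Fin.cons 1 ε)) + signMean (fun ε => g (Fin.cons (-1) ε))) / 2 := by
  have hc : ∀ (b : Bool) (ε : Fin n → Bool),
      (fun j => boolSign ((Fin.cons b ε : Fin (n + 1) → Bool) j)) =
        (Fin.cons (boolSign b) fun j => boolSign (ε j) : Fin (n + 1) → ℝ) := by
    intro b ε
    funext j
    refine Fin.cases ?_ (fun j => ?_) j <;> simp
  unfold signMean
  rw [← (Fin.consEquiv fun _ : Fin (n + 1) => Bool).sum_comp, Fintype.sum_prod_type]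
  simp only [Fintype.sum_bool, Fin.consEquiv_apply, hc]
  simp only [boolSign, cond_true, cond_false]
  rw [pow_succ]
  field_simp

theorem signMean_mono {n : ℕ} {g h : (Fin n → ℝ) → ℝ} (H : ∀ ε, (∀ j, |ε j| = 1) → g ε ≤ h ε) :
    signMean g ≤ signMean h := by
  unfold signMean
  gcongr with ε
  refine H _ fun j => ?_
  cases ε j <;> simp [boolSign]

theorem signMean_add {n : ℕ} (g h : (Fin n → ℝ) → ℝ) :
    signMean (fun ε => g ε + h ε) = signMean g + signMean h := by
  simp only [signMean, Finset.sum_add_distrib, add_div]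

theorem signMean_const_mul {n : ℕ} (c : ℝ) (g : (Fin n → ℝ) → ℝ) :
    signMean (fun ε => c * g ε) = c * signMean g := by
  simp only [signMean, ← Finset.mul_sum, mul_div_assoc]

theorem signMean_const {n : ℕ} (c : ℝ) : signMean (fun _ : Fin n → ℝ => c) = c := by
  simp [signMean]

theorem signMean_nonneg {n : ℕ} {g : (Fin n → ℝ) → ℝ} (H : ∀ ε, 0 ≤ g ε) : 0 ≤ signMean g := by
  unfold signMean
  exact div_nonneg (Finset.sum_nonneg fun ε _ => H _) (by positivity)

theorem signMean_neg {n : ℕ} (g : (Fin n → ℝ) → ℝ) : signMean (fun ε => g (-ε)) = signMean g := by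
  induction n with
  | zero => simp [signMean_zero]
  | succ n ih =>
    have hc : ∀ (a : ℝ) (ε : Fin n → ℝ),
        -(Fin.cons a ε : Fin (n + 1) → ℝ) = (Fin.cons (-a) (-ε) : Fin (n + 1) → ℝ) := by
      intro a ε
      funext j
      refine Fin.cases ?_ (fun j => ?_) j <;> simp
    rw [signMean_succ, signMean_succ g]
    simp only [hc, neg_neg]
    rw [ih fun ε => g (Fin.cons (-1) ε), ih fun ε => g (Fin.cons 1 ε), add_comm]

/-- Minkowski's inequality in `L_m` of the sign cube, stated with `m`th powers so that no roots
appear in the induction for hypercontractivity. -/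
theorem signMean_pow_add_le {n m : ℕ} (hm : 1 ≤ m) {g h : (Fin n → ℝ) → ℝ} (hg : ∀ ε, 0 ≤ g ε)
    (hh : ∀ ε, 0 ≤ h ε) {a b : ℝ} (ha : 0 ≤ a) (hb : 0 ≤ b)
    (hga : signMean (fun ε => g ε ^ m) ≤ a ^ m) (hhb : signMean (fun ε => h ε ^ m) ≤ b ^ m) :
    signMean (fun ε => (g ε + h ε) ^ m) ≤ (a + b) ^ m := by
  have key : ∀ {g : (Fin n → ℝ) → ℝ} {a : ℝ}, (∀ ε, 0 ≤ g ε) → 0 ≤ a →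
      ((∑ ε : Fin n → Bool, g (fun j => boolSign (ε j)) ^ (m : ℝ)) ^ (1 / (m : ℝ)) ≤
        a * (2 ^ n : ℝ) ^ (1 / (m : ℝ)) ↔ signMean (fun ε => g ε ^ m) ≤ a ^ m) := by
    intro g a hg ha
    have hm' : (0 : ℝ) < 1 / m := by positivity
    have : a * (2 ^ n : ℝ) ^ (1 / (m : ℝ)) = (a ^ m * 2 ^ n) ^ (1 / (m : ℝ)) := by
      rw [Real.mul_rpow (by positivity) (by positivity), one_div,
        Real.pow_rpow_inv_natCast ha (by omega)]
    rw [this, Real.rpow_le_rpow_iff (Finset.sum_nonneg fun _ _ => Real.rpow_nonneg (hg _) _)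
      (by positivity) hm', signMean, div_le_iff₀ (by positivity)]
    simp only [Real.rpow_natCast]
  refine (key (g := fun ε => g ε + h ε) (fun ε => add_nonneg (hg ε) (hh ε)) (by positivity)).mp ?_
  rw [add_mul]
  exact (Real.Lp_add_le_of_nonneg Finset.univ (p := m) (by exact_mod_cast hm) (fun _ _ => hg _)
    (fun _ _ => hh _)).trans (add_le_add ((key hg ha).mpr hga) ((key hh hb).mpr hhb))

/-! ### The contraction principle -/

/-- Increments of a convex function grow to the right, and monotonicity allows the right-hand
interval to be longer. -/
theorem Monotone.convexOn_sub_le_sub {G : ℝ → ℝ} (hG : Monotone G) (hc : ConvexOn ℝ Set.univ G)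
    {a b a' b' : ℝ} (hb : b ≤ a) (hbb : b ≤ b') (hd : a - b ≤ a' - b') :
    G a - G b ≤ G a' - G b' := by
  have h1 : G (b' + (a - b)) ≤ G a' := hG (by linarith)
  suffices G a - G b ≤ G (b' + (a - b)) - G b' by linarith
  rcases hb.eq_or_lt with rfl | hb
  · simp
  rcases hbb.eq_or_lt with rfl | hbb
  · simp
  -- The weight `l` places `a` and `b'` symmetrically between `b` and `b' + (a - b)`. Adding the two
  -- convexity inequalities gives `G a + G b' ≤ G b + G (b' + (a - b))`.
  set l := (a - b) / (b' - b + (a - b)) with hl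
  have hD : 0 < b' - b + (a - b) := by linarith
  have hl0 : 0 ≤ l := by rw [hl]; apply div_nonneg <;> linarith
  have hl1 : 0 ≤ 1 - l := by
    rw [hl, sub_nonneg, div_le_one hD]; linarith
  have hlD : l * (b' - b + (a - b)) = a - b := by rw [hl]; field_simp
  have e1 := hc.2 (Set.mem_univ b) (Set.mem_univ (b' + (a - b))) hl1 hl0 (by ring)
  have e2 := hc.2 (Set.mem_univ b) (Set.mem_univ (b' + (a - b))) hl0 hl1 (by ring)
  have f1 : (1 - l) • b + l • (b' + (a - b)) = a := by
    simp only [smul_eq_mul]; linear_combination hlD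
  have f2 : l • b + (1 - l) • (b' + (a - b)) = b' := by
    simp only [smul_eq_mul]; linear_combination -hlD
  rw [f1] at e1
  rw [f2] at e2
  simp only [smul_eq_mul] at e1 e2
  linarith

/-- If `t` and `t'` have opposite signs, monotonicity suffices. If they have the same sign, the
increment lemma is applied, and `hw1`, `hw2` ensure that the intervals lie in the right order.
Whether `h1` or its swapped version `h2` is used depends on the signs and on which of `t`, `t'` is
larger. -/
theorem two_point_contraction_aux {G : ℝ → ℝ} (hG : Monotone G) (hc : ConvexOn ℝ Set.univ G)
    {h h' u u' t t' R : ℝ} (hu : |u| ≤ |t|) (hu' : |u'| ≤ |t'|) (huu : |u - u'| ≤ |t - t'|)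
    (h1 : G (h + t) + G (h' - t') ≤ R) (h2 : G (h' + t') + G (h - t) ≤ R)
    (hw1 : h' + u' ≤ h + u) (hw2 : h - u ≤ h' - u') :
    G (h + u) + G (h' - u') ≤ R := by
  rcases abs_le.mp hu with ⟨_, _⟩
  rcases abs_le.mp hu' with ⟨_, _⟩
  rcases abs_le.mp huu with ⟨_, _⟩
  rcases le_total 0 t with ht | ht <;> rcases le_total 0 t' with ht' | ht'
  · have A := abs_of_nonneg ht
    have B := abs_of_nonneg ht'
    rcases le_total t' t with h3 | h3
    · have := Monotone.convexOn_sub_le_sub hG hc (a := h' - u') (b := h' - t') (a' := h + t)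
        (b' := h + u) (by linarith) (by linarith)
        (by linarith [abs_of_nonneg (sub_nonneg.mpr h3)])
      linarith
    · have := Monotone.convexOn_sub_le_sub hG hc (a := h + u) (b := h - t) (a' := h' + t')
        (b' := h' - u') (by linarith) (by linarith)
        (by linarith [abs_of_nonpos (sub_nonpos.mpr h3)])
      linarith
  · have A := abs_of_nonneg ht
    have B := abs_of_nonpos ht'
    have e1 : G (h + u) ≤ G (h + t) := hG (by linarith)
    have e2 : G (h' - u') ≤ G (h' - t') := hG (by linarith)
    linarith
  · have A := abs_of_nonpos ht
    have B := abs_of_nonneg ht'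
    have e1 : G (h + u) ≤ G (h - t) := hG (by linarith)
    have e2 : G (h' - u') ≤ G (h' + t') := hG (by linarith)
    linarith
  · have A := abs_of_nonpos ht
    have B := abs_of_nonpos ht'
    rcases le_total t' t with h3 | h3
    · have := Monotone.convexOn_sub_le_sub hG hc (a := h + u) (b := h + t) (a' := h' - t')
        (b' := h' - u') (by linarith) (by linarith)
        (by linarith [abs_of_nonneg (sub_nonneg.mpr h3)])
      linarith
    · have := Monotone.convexOn_sub_le_sub hG hc (a := h' - u') (b := h' + t') (a' := h - t)
        (b' := h + u) (by linarith) (by linarith)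
        (by linarith [abs_of_nonpos (sub_nonpos.mpr h3)])
      linarith

/-- If one of the ordering conditions of the auxiliary lemma fails, a single index does at least as
well in both terms, and the diagonal case bounds the sum. -/
theorem two_point_contraction {ι : Type*} {G : ℝ → ℝ} (hG : Monotone G)
    (hc : ConvexOn ℝ Set.univ G) {h u t : ι → ℝ} {R : ℝ} (hu : ∀ i, |u i| ≤ |t i|)
    (huu : ∀ i i', |u i - u i'| ≤ |t i - t i'|)
    (hR : ∀ i i', G (h i + t i) + G (h i' - t i') ≤ R) (i i' : ι) :
    G (h i + u i) + G (h i' - u i') ≤ R := by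
  have diag : ∀ i, G (h i + u i) + G (h i - u i) ≤ R := fun i =>
    two_point_contraction_aux hG hc (hu i) (hu i) (huu i i) (hR i i) (hR i i) le_rfl le_rfl
  rcases le_total (h i' + u i') (h i + u i) with h1 | h1
  · rcases le_total (h i - u i) (h i' - u i') with h2 | h2
    · exact two_point_contraction_aux hG hc (hu i) (hu i') (huu i i') (hR i i') (hR i' i) h1 h2
    · have := hG h2
      linarith [diag i]
  · have := hG h1
    linarith [diag i']

theorem two_point_iSup_contraction {ι : Type*} [Nonempty ι] {G : ℝ → ℝ} (hG : Monotone G)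
    (hcont : Continuous G) (hc : ConvexOn ℝ Set.univ G) {h u t : ι → ℝ}
    {C D : ℝ} (hh : ∀ i, |h i| ≤ C) (ht : ∀ i, |t i| ≤ D) (hu : ∀ i, |u i| ≤ |t i|)
    (huu : ∀ i i', |u i - u i'| ≤ |t i - t i'|) :
    G (⨆ i, (h i + u i)) + G (⨆ i, (h i - u i)) ≤ G (⨆ i, (h i + t i)) + G (⨆ i, (h i - t i)) := by
  have bd : ∀ (w : ι → ℝ), (∀ i, |w i| ≤ D) → BddAbove (Set.range fun i => h i + w i) := by
    rintro w hw
    refine ⟨C + D, ?_⟩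
    rintro _ ⟨i, rfl⟩
    exact add_le_add ((le_abs_self _).trans (hh i)) ((le_abs_self _).trans (hw i))
  have bd' : ∀ (w : ι → ℝ), (∀ i, |w i| ≤ D) → BddAbove (Set.range fun i => h i - w i) := by
    intro w hw
    simpa only [sub_eq_add_neg] using bd (fun i => -w i) fun i => by rw [abs_neg]; exact hw i
  have hu' : ∀ i, |u i| ≤ D := fun i => (hu i).trans (ht i)
  rw [hG.map_ciSup_of_continuousAt hcont.continuousAt (bd u hu'),
    hG.map_ciSup_of_continuousAt hcont.continuousAt (bd' u hu')]
  refine ciSup_add_ciSup_le fun i i' => ?_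
  exact two_point_contraction hG hc hu huu (fun i i' => add_le_add
    (hG (le_ciSup (bd t ht) i)) (hG (le_ciSup (bd' t ht) i'))) i i'

/-- The contraction principle for suprema of sign averages. -/
theorem signMean_iSup_contraction {ι : Type*} [Nonempty ι] {G : ℝ → ℝ} (hG : Monotone G)
    (hcont : Continuous G) (hc : ConvexOn ℝ Set.univ G) {n : ℕ} {h : ι → ℝ} {u t : Fin n → ι → ℝ}
    {C D : ℝ} (hh : ∀ i, |h i| ≤ C) (ht : ∀ j i, |t j i| ≤ D) (hu : ∀ j i, |u j i| ≤ |t j i|)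
    (huu : ∀ j i i', |u j i - u j i'| ≤ |t j i - t j i'|) :
    signMean (fun ε => G (⨆ i, (h i + ∑ j, ε j * u j i))) ≤
      signMean (fun ε => G (⨆ i, (h i + ∑ j, ε j * t j i))) := by
  -- The first sign is absorbed into the offset `h`, which must therefore be arbitrary.
  induction n generalizing h C with
  | zero => simp
  | succ n ih =>
    have hD : 0 ≤ D := (abs_nonneg _).trans (ht 0 (Classical.arbitrary ι))
    have step : ∀ a : ℝ, |a| = 1 →
        signMean (fun ε => G (⨆ i, ((h i + a * t 0 i) + ∑ j : Fin n, ε j * u j.succ i))) ≤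
          signMean (fun ε => G (⨆ i, ((h i + a * t 0 i) + ∑ j : Fin n, ε j * t j.succ i))) := by
      intro a ha
      refine ih (C := C + D) (fun i => (abs_add_le _ _).trans (add_le_add (hh i) ?_))
        (fun j => ht j.succ) (fun j => hu j.succ) (fun j => huu j.succ)
      rw [abs_mul, ha, one_mul]
      exact ht 0 i
    have s1 := step 1 (by simp)
    have s2 := step (-1) (by simp)
    -- With the other signs frozen, the first coordinate is contracted by the two-point case. Then
    -- `s1` and `s2` contract the remaining coordinates for each value of the first sign.
    have s3 : signMean (fun ε : Fin n → ℝ =>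
          G (⨆ i, ((h i + 1 * u 0 i) + ∑ j : Fin n, ε j * u j.succ i)) +
          G (⨆ i, ((h i + (-1) * u 0 i) + ∑ j : Fin n, ε j * u j.succ i))) ≤
        signMean (fun ε : Fin n → ℝ =>
          G (⨆ i, ((h i + 1 * t 0 i) + ∑ j : Fin n, ε j * u j.succ i)) +
          G (⨆ i, ((h i + (-1) * t 0 i) + ∑ j : Fin n, ε j * u j.succ i))) := by
      refine signMean_mono fun ε hε => ?_
      have := two_point_iSup_contraction hG hcont hc (h := fun i => h i + ∑ j : Fin n, ε j * u j.succ i)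
        (u := u 0) (t := t 0) (C := C + n * D) (fun i => (abs_add_le _ _).trans
          (add_le_add (hh i) ((Finset.abs_sum_le_sum_abs _ _).trans ?_))) (ht 0) (hu 0) (huu 0)
      · convert this using 5 <;> ring
      · refine (Finset.sum_le_card_nsmul _ _ D fun j _ => ?_).trans (by simp)
        rw [abs_mul, hε, one_mul]
        exact (hu _ i).trans (ht _ i)
    rw [signMean_add, signMean_add] at s3
    rw [signMean_succ, signMean_succ]
    simp only [Fin.sum_univ_succ, Fin.cons_zero, Fin.cons_succ, ← add_assoc]
    linarith

end InjectiveMoments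

namespace InjectiveMoments

/-! ### Hypercontractivity and the Kahane–Khintchine inequality -/

/-- Put `f_n = (s+d)^n + (s-d)^n` and `g_n = (s+d)^n - (s-d)^n`. Then `f_{n+1} = s f_n + d g_n`, and
it suffices to show `d g_n ≤ (1 - ρ²) B² f_n`, for then each step multiplies `f_n` by at most `A² +
B²`. -/
theorem two_point_pow_bounds {A B ρ : ℝ} (hA : 0 ≤ A) (hB : 0 ≤ B) (hρ : 0 < ρ) (m : ℕ)
    (hm : ρ ^ 2 * (4 * m + 1) ≤ 1) :
    (A + ρ * B) ^ (2 * m) + (A - ρ * B) ^ (2 * m) ≤ 2 * (A ^ 2 + B ^ 2) ^ m := by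
  set s := A ^ 2 + ρ ^ 2 * B ^ 2 with hs
  set d := 2 * ρ * A * B with hd
  have hs0 : 0 ≤ s := by positivity
  have hd0 : 0 ≤ d := by positivity
  have hsd : d ≤ s := by nlinarith [sq_nonneg (A - ρ * B)]
  have e1 : (A + ρ * B) ^ 2 = s + d := by rw [hs, hd]; ring
  have e2 : (A - ρ * B) ^ 2 = s - d := by rw [hs, hd]; ring
  rw [pow_mul, pow_mul, e1, e2]
  have hf : ∀ n : ℕ, 0 ≤ (s + d) ^ n + (s - d) ^ n := fun n =>
    add_nonneg (pow_nonneg (by linarith) _) (pow_nonneg (by linarith) _)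
  have hg : ∀ n : ℕ, 0 ≤ (s + d) ^ n - (s - d) ^ n := fun n =>
    sub_nonneg.mpr (pow_le_pow_left₀ (by linarith) (by linarith) _)
  have hfg : ∀ n : ℕ, s * ((s + d) ^ n - (s - d) ^ n) ≤ n * d * ((s + d) ^ n + (s - d) ^ n) := by
    intro n
    induction n with
    | zero => simp
    | succ n ih =>
      have h1 := mul_le_mul_of_nonneg_left ih hs0
      have h2 : 0 ≤ (n + 1) * d * (d * ((s + d) ^ n - (s - d) ^ n)) :=
        mul_nonneg (by positivity) (mul_nonneg hd0 (hg n))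
      push_cast
      rw [pow_succ, pow_succ]
      nlinarith
  have main : ∀ n : ℕ, n ≤ m → (s + d) ^ n + (s - d) ^ n ≤ 2 * (A ^ 2 + B ^ 2) ^ n := by
    intro n
    induction n with
    | zero => intro _; norm_num
    | succ n ih =>
      intro hn
      have ih := ih (by omega)
      have key : d * ((s + d) ^ n - (s - d) ^ n) ≤
          (1 - ρ ^ 2) * B ^ 2 * ((s + d) ^ n + (s - d) ^ n) := by
        have hn' : ρ ^ 2 * (4 * n + 1) ≤ 1 := by
          refine le_trans ?_ hm
          have : (n : ℝ) ≤ m := by exact_mod_cast (by omega : n ≤ m)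
          gcongr
        rcases hs0.eq_or_lt with h0 | h0
        · have : d = 0 := by linarith
          rw [this, zero_mul]
          have : ρ ^ 2 ≤ 1 := by nlinarith [sq_nonneg ρ, (Nat.cast_nonneg n : (0 : ℝ) ≤ n)]
          exact mul_nonneg (mul_nonneg (by linarith) (sq_nonneg B)) (by simpa [‹d = 0›] using hf n)
        · refine le_of_mul_le_mul_left ?_ h0
          have h1 := mul_le_mul_of_nonneg_left (hfg n) hd0
          -- Since `d² = 4ρ²A²B²`, this is where `ρ²(4n + 1) ≤ 1` is needed.
          have h2 : n * d ^ 2 ≤ (1 - ρ ^ 2) * B ^ 2 * s := by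
            have : 4 * n * ρ ^ 2 * (A ^ 2 * B ^ 2) ≤ (1 - ρ ^ 2) * (A ^ 2 * B ^ 2) :=
              mul_le_mul_of_nonneg_right (by linarith) (by positivity)
            have h3 : 0 ≤ (1 - ρ ^ 2) * (ρ ^ 2 * B ^ 4) := by
              refine mul_nonneg ?_ (by positivity)
              nlinarith [sq_nonneg ρ, (Nat.cast_nonneg n : (0 : ℝ) ≤ n)]
            rw [hs, hd]
            nlinarith
          have h3 := mul_le_mul_of_nonneg_right h2 (hf n)
          nlinarith
      have h4 : (s + d) ^ (n + 1) + (s - d) ^ (n + 1) ≤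
          (A ^ 2 + B ^ 2) * ((s + d) ^ n + (s - d) ^ n) := by
        rw [pow_succ, pow_succ]
        nlinarith
      refine h4.trans ?_
      rw [pow_succ (A ^ 2 + B ^ 2)]
      linarith [mul_le_mul_of_nonneg_left ih (by positivity : 0 ≤ A ^ 2 + B ^ 2)]
  exact main m le_rfl

section Kahane

variable {F : Type*} [NormedAddCommGroup F] [NormedSpace ℝ F]

/-- Both `v ± ρx` are convex combinations of `v + x` and `v - x`, so the claim reduces to the scalar
inequality with `A` the half-sum and `B` the absolute half-difference of the two norms. -/
theorem norm_two_point_pow_le (v x : F) {ρ : ℝ} (hρ : 0 < ρ) (m : ℕ)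
    (hm : ρ ^ 2 * (4 * m + 1) ≤ 1) :
    ‖v + ρ • x‖ ^ (2 * m) + ‖v - ρ • x‖ ^ (2 * m) ≤
      2 * ((‖v + x‖ ^ 2 + ‖v - x‖ ^ 2) / 2) ^ m := by
  have hρ1 : ρ ≤ 1 := by nlinarith [sq_nonneg ρ, (Nat.cast_nonneg m : (0 : ℝ) ≤ m)]
  set a := ‖v + x‖
  set b := ‖v - x‖
  have h1 : ‖v + ρ • x‖ ≤ (a + b) / 2 + ρ * ((a - b) / 2) := by
    have : v + ρ • x = ((1 + ρ) / 2) • (v + x) + ((1 - ρ) / 2) • (v - x) := by module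
    rw [this]
    refine (norm_add_le _ _).trans ?_
    rw [norm_smul, norm_smul, Real.norm_of_nonneg (by linarith), Real.norm_of_nonneg (by linarith)]
    exact le_of_eq (by ring)
  have h2 : ‖v - ρ • x‖ ≤ (a + b) / 2 - ρ * ((a - b) / 2) := by
    have : v - ρ • x = ((1 - ρ) / 2) • (v + x) + ((1 + ρ) / 2) • (v - x) := by module
    rw [this]
    refine (norm_add_le _ _).trans ?_
    rw [norm_smul, norm_smul, Real.norm_of_nonneg (by linarith), Real.norm_of_nonneg (by linarith)]
    exact le_of_eq (by ring)
  have ha : 0 ≤ a := norm_nonneg _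
  have hb : 0 ≤ b := norm_nonneg _
  have h3 : ((a + b) / 2 + ρ * ((a - b) / 2)) ^ (2 * m) +
      ((a + b) / 2 - ρ * ((a - b) / 2)) ^ (2 * m) ≤ 2 * ((a ^ 2 + b ^ 2) / 2) ^ m := by
    have e : (a ^ 2 + b ^ 2) / 2 = ((a + b) / 2) ^ 2 + ((a - b) / 2) ^ 2 := by ring
    rw [e]
    rcases le_total b a with h | h
    · exact two_point_pow_bounds (by positivity) (by linarith) hρ m hm
    · have := two_point_pow_bounds (A := (a + b) / 2) (B := -((a - b) / 2)) (by positivity)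
        (by linarith) hρ m hm
      rw [neg_sq] at this
      rw [mul_neg, sub_neg_eq_add, ← sub_eq_add_neg] at this
      linarith
  exact (add_le_add (pow_le_pow_left₀ (norm_nonneg _) h1 _)
    (pow_le_pow_left₀ (norm_nonneg _) h2 _)).trans h3

/-- Bonami-type tensorization: the two-point inequality handles one sign at a time, and Minkowski in
`L_m` recombines the two branches. The offset `v` absorbs the signs already fixed. -/
theorem signMean_hypercontractive {ρ : ℝ} (hρ : 0 < ρ) {m : ℕ} (hm1 : 1 ≤ m)
    (hm : ρ ^ 2 * (4 * m + 1) ≤ 1) {n : ℕ} (v : F) (x : Fin n → F) :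
    signMean (fun ε => ‖v + ρ • ∑ j, ε j • x j‖ ^ (2 * m)) ≤
      signMean (fun ε => ‖v + ∑ j, ε j • x j‖ ^ 2) ^ m := by
  induction n generalizing v with
  | zero => simp [signMean_zero, pow_mul]
  | succ n ih =>
    rw [signMean_succ, signMean_succ]
    simp only [Fin.sum_univ_succ, Fin.cons_zero, Fin.cons_succ, one_smul, neg_smul]
    have i1 := ih (v + x 0) fun j => x j.succ
    have i2 := ih (v - x 0) fun j => x j.succ
    have n1 : 0 ≤ signMean (fun ε => ‖v + (x 0 + ∑ j, ε j • x j.succ)‖ ^ 2) :=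
      signMean_nonneg fun _ => by positivity
    have n2 : 0 ≤ signMean (fun ε => ‖v + (-x 0 + ∑ j, ε j • x j.succ)‖ ^ 2) :=
      signMean_nonneg fun _ => by positivity
    simp only [pow_mul, add_assoc, sub_eq_add_neg] at i1 i2
    have j1 := signMean_pow_add_le hm1
      (g := fun ε => 1 / 2 * ‖v + (x 0 + ρ • ∑ j, ε j • x j.succ)‖ ^ 2)
      (h := fun ε => 1 / 2 * ‖v + (-x 0 + ρ • ∑ j, ε j • x j.succ)‖ ^ 2)
      (a := 1 / 2 * signMean (fun ε => ‖v + (x 0 + ∑ j, ε j • x j.succ)‖ ^ 2))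
      (b := 1 / 2 * signMean (fun ε => ‖v + (-x 0 + ∑ j, ε j • x j.succ)‖ ^ 2))
      (fun _ => by positivity) (fun _ => by positivity) (by positivity) (by positivity)
      (by simp only [mul_pow, signMean_const_mul]; gcongr)
      (by simp only [mul_pow, signMean_const_mul]; gcongr)
    refine le_trans ?_ (j1.trans (le_of_eq (by ring)))
    rw [← signMean_add, div_le_iff₀ two_pos, mul_comm _ (2 : ℝ), ← signMean_const_mul]
    refine signMean_mono fun ε _ => ?_
    have := norm_two_point_pow_le (v + ρ • ∑ j, ε j • x j.succ) (x 0) hρ m hm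
    rw [show v + ρ • (x 0 + ∑ j, ε j • x j.succ) = v + ρ • ∑ j, ε j • x j.succ + ρ • x 0 by module,
      show v + ρ • (-x 0 + ∑ j, ε j • x j.succ) = v + ρ • ∑ j, ε j • x j.succ - ρ • x 0 by module,
      show v + (x 0 + ρ • ∑ j, ε j • x j.succ) = v + ρ • ∑ j, ε j • x j.succ + x 0 by module,
      show v + (-x 0 + ρ • ∑ j, ε j • x j.succ) = v + ρ • ∑ j, ε j • x j.succ - x 0 by module]
    refine this.trans (le_of_eq ?_)
    ring

theorem signMean_pow_le_signMean_sq {ρ : ℝ} (hρ : 0 < ρ) {m : ℕ} (hm1 : 1 ≤ m)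
    (hm : ρ ^ 2 * (4 * m + 1) ≤ 1) {n : ℕ} (x : Fin n → F) :
    ρ ^ (2 * m) * signMean (fun ε => ‖∑ j, ε j • x j‖ ^ (2 * m)) ≤
      signMean (fun ε => ‖∑ j, ε j • x j‖ ^ 2) ^ m := by
  have := signMean_hypercontractive hρ hm1 hm 0 x
  simpa only [zero_add, norm_smul, mul_pow, signMean_const_mul, Real.norm_of_nonneg hρ.le] using this

/-- The second moment is interpolated between the first and the fourth. Taking `m = 2`, `ρ = 1/3`
bounds the fourth moment by `81 V²`. -/
theorem signMean_sq_le_signMean {n : ℕ} (x : Fin n → F) :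
    signMean (fun ε => ‖∑ j, ε j • x j‖ ^ 2) ≤
      (26 * signMean (fun ε => ‖∑ j, ε j • x j‖)) ^ 2 := by
  have h4 := signMean_pow_le_signMean_sq (ρ := 1 / 3) (by norm_num) (m := 2) (by norm_num)
    (by norm_num) x
  set V := signMean (fun ε => ‖∑ j, ε j • x j‖ ^ 2) with hV
  set A := signMean (fun ε => ‖∑ j, ε j • x j‖) with hA
  have hV0 : 0 ≤ V := signMean_nonneg fun _ => by positivity
  have hA0 : 0 ≤ A := signMean_nonneg fun _ => by positivity
  rcases hV0.eq_or_lt with h0 | h0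
  · rw [← h0]; positivity
  obtain ⟨s, hs, hsV⟩ : ∃ s : ℝ, 0 < s ∧ s ^ 2 = V := ⟨√V, Real.sqrt_pos.mpr h0, Real.sq_sqrt hV0⟩
  -- The cutoff `13 s` is chosen because `81 / 13² < 1/2`: after averaging, the quartic term is at
  -- most `s² / 2` and is absorbed, leaving `s ≤ 26 A`.
  have hc : ∀ t : ℝ, 0 ≤ t → t ^ 2 ≤ 13 * s * t + 1 / (13 * s) ^ 2 * t ^ (2 * 2) := by
    intro t ht
    rcases le_total t (13 * s) with h | h
    · have : 0 ≤ 1 / (13 * s) ^ 2 * t ^ (2 * 2) := by positivity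
      nlinarith
    · have h1 : t ^ 2 ≤ 1 / (13 * s) ^ 2 * t ^ (2 * 2) := by
        rw [one_div_mul_eq_div, le_div_iff₀ (by positivity)]
        have : (13 * s) ^ 2 ≤ t ^ 2 := by gcongr
        calc t ^ 2 * (13 * s) ^ 2 ≤ t ^ 2 * t ^ 2 := by gcongr
          _ = t ^ (2 * 2) := by ring
      have : 0 ≤ 13 * s * t := by positivity
      linarith
  have h2 := signMean_mono (g := fun ε => ‖∑ j, ε j • x j‖ ^ 2) fun ε _ =>
    hc ‖∑ j, ε j • x j‖ (norm_nonneg _)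
  rw [signMean_add, signMean_const_mul, signMean_const_mul, ← hV, ← hA, ← hsV] at h2
  rw [← hsV] at h4 ⊢
  have h3 : 1 / (13 * s) ^ 2 * signMean (fun ε => ‖∑ j, ε j • x j‖ ^ (2 * 2)) ≤ s ^ 2 / 2 := by
    rw [one_div_mul_eq_div, div_le_iff₀ (by positivity)]
    nlinarith [sq_nonneg (s ^ 2)]
  have h5 : s * s ≤ s * (26 * A) := by nlinarith
  exact pow_le_pow_left₀ hs.le (le_of_mul_le_mul_left h5 hs) 2

end Kahane

/-! ### Rademacher families and averages over signs -/

section Transfer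

variable {Ω : Type v} [MeasurableSpace Ω] {P : Measure Ω} {r : ℕ → Ω → ℝ}

theorem IsRademacherFamily.measureReal_signs (hr : IsRademacherFamily P r) {n : ℕ}
    (ε : Fin n → Bool) : P.real {ω | ∀ j : Fin n, r j ω = boolSign (ε j)} = 1 / 2 ^ n := by
  have := hr.isProbabilityMeasure
  have hi : iIndepFun (fun j : Fin n => r j) P := hr.indep.precomp Fin.val_injective
  have h := hi.measure_inter_preimage_eq_mul Finset.univ (sets := fun j => {boolSign (ε j)})
    fun _ _ => measurableSet_singleton _
  have e : {ω | ∀ j : Fin n, r j ω = boolSign (ε j)} =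
      ⋂ j ∈ Finset.univ, r (j : Fin n) ⁻¹' {boolSign (ε j)} := by
    ext ω; simp
  have hP : ∀ j : Fin n, P (r j ⁻¹' {boolSign (ε j)}) = 1 / 2 := by
    intro j
    cases ε j
    · exact hr.prob_neg_one j
    · exact hr.prob_one j
  rw [measureReal_def, e, h, Finset.prod_congr rfl fun j _ => hP j]
  simp

theorem IsRademacherFamily.integral_eq_signMean (hr : IsRademacherFamily P r) {n : ℕ}
    (g : (Fin n → ℝ) → ℝ) : ∫ ω, g (fun j => r j ω) ∂P = signMean g := by
  have := hr.isProbabilityMeasure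
  have hm : ∀ ε : Fin n → Bool, MeasurableSet {ω | ∀ j : Fin n, r j ω = boolSign (ε j)} := by
    intro ε
    rw [Set.ofPred_forall]
    exact MeasurableSet.iInter fun j => hr.measurable j (measurableSet_singleton _)
  have e : ∀ ω, g (fun j => r j ω) = ∑ ε : Fin n → Bool,
      {ω | ∀ j : Fin n, r j ω = boolSign (ε j)}.indicator (fun _ => g fun j => boolSign (ε j)) ω := by
    intro ω
    have hex : ∀ j : Fin n, ∃ b, r j ω = boolSign b := fun j => by
      rcases hr.values j ω with h | h
      · exact ⟨true, h⟩
      · exact ⟨false, h⟩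
    choose ε hε using hex
    have hinj : ∀ b b', boolSign b = boolSign b' → b = b' := by
      intro b b'
      cases b <;> cases b' <;> norm_num [boolSign]
    rw [Finset.sum_eq_single ε]
    · rw [Set.indicator_of_mem (by exact hε)]
      exact congrArg g (funext hε)
    · intro ε' _ hne
      refine Set.indicator_of_notMem (fun h => hne (funext fun j => hinj _ _ ?_)) _
      rw [← hε j]
      exact (h j).symm
    · simp
  simp_rw [e]
  rw [integral_finsetSum _ fun ε _ => (integrable_const _).indicator (hm ε)]
  simp_rw [integral_indicator_const _ (hm _), hr.measureReal_signs, smul_eq_mul]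
  rw [← Finset.mul_sum, signMean]
  ring

variable {F : Type*} [NormedAddCommGroup F] [NormedSpace ℝ F]

theorem IsRademacherFamily.memLp_sum (hr : IsRademacherFamily P r) {n : ℕ} (x : Fin n → F)
    (s : ℝ≥0∞) : MemLp (fun ω => ∑ j : Fin n, r j ω • x j) s P := by
  have := hr.isProbabilityMeasure
  refine memLp_finsetSum _ fun j _ => ?_
  refine MemLp.of_bound (((hr.measurable j).stronglyMeasurable.smul_const _).aestronglyMeasurable)
    ‖x j‖ (Filter.Eventually.of_forall fun ω => ?_)
  rcases hr.values j ω with h | h <;> simp [h]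

theorem IsRademacherFamily.lpNorm_sum (hr : IsRademacherFamily P r) {n : ℕ} (x : Fin n → F)
    {s : ℝ} (hs : 0 < s) :
    lpNorm (fun ω => ∑ j : Fin n, r j ω • x j) (ENNReal.ofReal s) P =
      signMean (fun ε => ‖∑ j, ε j • x j‖ ^ s) ^ (1 / s) := by
  rw [lpNorm_eq_integral_norm_rpow_toReal (by simpa using hs) ENNReal.ofReal_ne_top
    (hr.memLp_sum x 1).1, ENNReal.toReal_ofReal hs.le, one_div,
    ← hr.integral_eq_signMean fun ε => ‖∑ j, ε j • x j‖ ^ s]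

/-! ### Finiteness of the Kahane–Khintchine constants, and existence of Rademacher families -/

theorem lpNorm_mono_exponent {α G : Type*} [MeasurableSpace α] [NormedAddCommGroup G]
    {μ : Measure α} [IsProbabilityMeasure μ] {f : α → G} {s t : ℝ≥0∞} (hst : s ≤ t)
    (hf : MemLp f t μ) : lpNorm f s μ ≤ lpNorm f t μ := by
  rw [← toReal_eLpNorm hf.1, ← toReal_eLpNorm hf.1]
  exact ENNReal.toReal_mono hf.eLpNorm_ne_top (eLpNorm_le_eLpNorm_of_exponent_le hst hf.1)

/-- The chain is `L_q ≤ L_{2m} ≤ ρ⁻¹ L_2 ≤ 26 ρ⁻¹ L_1 ≤ 26 ρ⁻¹ L_p`, with a constant independent of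
the space and of the number of vectors. -/
theorem exists_isKahaneKhintchineBound {q p : ℝ} (hp : 1 ≤ p) :
    ∃ K, IsKahaneKhintchineBound.{u} q p K := by
  obtain ⟨m, hm1, hmq⟩ : ∃ m : ℕ, 1 ≤ m ∧ q ≤ 2 * m := by
    obtain ⟨m, hm⟩ := exists_nat_ge q
    refine ⟨m + 1, by omega, ?_⟩
    push_cast
    linarith [(Nat.cast_nonneg m : (0 : ℝ) ≤ m)]
  set ρ : ℝ := 1 / (4 * m + 1) with hρ
  have hρ0 : 0 < ρ := by positivity
  have hρm : ρ ^ 2 * (4 * m + 1) ≤ 1 := by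
    have : ρ ^ 2 * (4 * m + 1) = ρ := by rw [hρ]; field_simp
    rw [this, hρ, div_le_one (by positivity)]
    linarith [(Nat.cast_nonneg m : (0 : ℝ) ≤ m)]
  refine ⟨26 / ρ, by positivity, ?_⟩
  intro Ω _ P r hr F _ _ _ n x
  have := hr.isProbabilityMeasure
  set A := signMean (fun ε => ‖∑ j, ε j • x j‖) with hA
  have hA0 : 0 ≤ A := signMean_nonneg fun _ => by positivity
  calc lpNorm (fun ω => ∑ j : Fin n, r j ω • x j) (ENNReal.ofReal q) P
      ≤ lpNorm (fun ω => ∑ j : Fin n, r j ω • x j) (ENNReal.ofReal ((2 * m : ℕ) : ℝ)) P :=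
        lpNorm_mono_exponent (ENNReal.ofReal_le_ofReal (by push_cast; exact hmq)) (hr.memLp_sum x _)
    _ ≤ 26 / ρ * A := by
        have hm0 : (0 : ℝ) < ((2 * m : ℕ) : ℝ) := by exact_mod_cast (by omega : 0 < 2 * m)
        rw [hr.lpNorm_sum x hm0, one_div]
        refine (Real.rpow_inv_le_iff_of_pos (signMean_nonneg fun _ => by positivity)
          (by positivity) hm0).mpr ?_
        simp only [Real.rpow_natCast]
        have h1 := signMean_pow_le_signMean_sq hρ0 hm1 hρm x
        have h2 := pow_le_pow_left₀ (signMean_nonneg fun _ => by positivity)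
          (signMean_sq_le_signMean x) m
        rw [← pow_mul] at h2
        rw [div_mul_eq_mul_div, div_pow, le_div_iff₀ (by positivity), mul_comm]
        exact h1.trans h2
    _ = 26 / ρ * lpNorm (fun ω => ∑ j : Fin n, r j ω • x j) (ENNReal.ofReal 1) P := by
        rw [hr.lpNorm_sum x one_pos]
        simp [hA]
    _ ≤ _ := by
        gcongr
        exact lpNorm_mono_exponent (ENNReal.ofReal_le_ofReal hp) (hr.memLp_sum x _)

/-- Rademacher families exist. -/
theorem exists_isRademacherFamily : ∃ (Ω : Type) (_ : MeasurableSpace Ω) (P : Measure Ω)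
    (r : ℕ → Ω → ℝ), IsRademacherFamily P r := by
  let ν : Measure Bool := uniformOn Set.univ
  have : IsProbabilityMeasure ν := isProbabilityMeasure_uniformOn Set.finite_univ Set.univ_nonempty
  let μ : Measure (ℕ → Bool) := Measure.infinitePi fun _ => ν
  have hb : ∀ b, ν {b} = 1 / 2 := by
    intro b
    change uniformOn Set.univ {b} = _
    rw [uniformOn_univ]
    simp
  have hmeas : ∀ j : ℕ, Measurable fun ω : ℕ → Bool => boolSign (ω j) := fun j =>
    (measurable_of_countable boolSign).comp (measurable_pi_apply j)
  have hμ : ∀ (j : ℕ) (b : Bool), μ {ω | ω j = b} = 1 / 2 := by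
    intro j b
    rw [← hb b, ← (measurePreserving_eval_infinitePi (fun _ : ℕ => ν) j).measure_preimage
      (measurableSet_singleton b).nullMeasurableSet]
    rfl
  -- Completing the coin-tossing measure meets the completeness requirement; it changes the measure
  -- of no set, so the laws and the independence carry over.
  refine ⟨NullMeasurableSpace (ℕ → Bool) μ, inferInstance, μ.completion,
    fun j ω => boolSign ((ω : ℕ → Bool) j), ?_⟩
  refine ⟨⟨?_⟩, inferInstance, fun j s hs => ?_, fun j ω => ?_, fun j => ?_, fun j => ?_, ?_⟩
  · exact (Measure.completion_apply μ _).trans measure_univ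
  · exact (hmeas j hs).nullMeasurableSet
  · cases ω j <;> simp [boolSign]
  · refine (Measure.completion_apply μ _).trans ((congrArg μ ?_).trans (hμ j true))
    ext ω
    change boolSign (ω j) = 1 ↔ ω j = true
    cases ω j <;> norm_num [boolSign]
  · refine (Measure.completion_apply μ _).trans ((congrArg μ ?_).trans (hμ j false))
    ext ω
    change boolSign (ω j) = -1 ↔ ω j = false
    cases ω j <;> norm_num [boolSign]
  · have h : iIndepFun (fun (j : ℕ) (ω : ℕ → Bool) => boolSign (ω j)) μ :=
      iIndepFun_infinitePi (P := fun _ : ℕ => ν) (X := fun _ b => boolSign b)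
        fun _ => measurable_of_countable boolSign
    rw [iIndepFun_iff_measure_inter_preimage_eq_mul] at h ⊢
    intro S sets hS
    exact (Measure.completion_apply μ _).trans ((h S hS).trans
      (Finset.prod_congr rfl fun i _ => (Measure.completion_apply μ _).symm))

end Transfer

end InjectiveMoments

namespace InjectiveMoments

/-! ### Continuity of tensor powers and evaluation functionals -/

section Tensor

variable {k : ℕ} {E : Type u} [NormedAddCommGroup E] [NormedSpace ℝ E]

theorem AlgTensor.abs_eval_le_norm (f : Fin k → StrongDual ℝ E) (hf : ∀ n, ‖f n‖ ≤ 1)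
    (U : AlgTensor k E) : |AlgTensor.eval f U| ≤ ‖U‖ := by
  obtain ⟨C, hC⟩ := AlgTensor.bddAbove U
  refine le_ciSup (f := fun f : DualBallTuple k E =>
    |AlgTensor.eval (fun n => (f n : StrongDual ℝ E)) U|) ⟨C, ?_⟩
    (fun n => ⟨f n, mem_closedBall_zero_iff.mpr (hf n)⟩)
  rintro _ ⟨g, rfl⟩
  exact hC _ fun n => mem_closedBall_zero_iff.mp (g n).2

theorem SymAlgTensor.abs_eval_le_norm (f : StrongDual ℝ E) (hf : ‖f‖ ≤ 1)
    (U : SymAlgTensor k E) :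
    |AlgTensor.eval (fun _ => f) (SymAlgTensor.incl k E U)| ≤ ‖U‖ := by
  obtain ⟨C, hC⟩ := AlgTensor.bddAbove (SymAlgTensor.incl k E U)
  refine le_ciSup (f := fun f : Metric.closedBall (0 : StrongDual ℝ E) 1 =>
    |AlgTensor.eval (fun _ => (f : StrongDual ℝ E)) (SymAlgTensor.incl k E U)|) ⟨C, ?_⟩
    ⟨f, mem_closedBall_zero_iff.mpr hf⟩
  rintro _ ⟨g, rfl⟩
  exact hC _ fun n => mem_closedBall_zero_iff.mp g.2

theorem SymAlgTensor.norm_le {U : SymAlgTensor k E} {C : ℝ}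
    (h : ∀ f : StrongDual ℝ E, ‖f‖ ≤ 1 →
      |AlgTensor.eval (fun _ => f) (SymAlgTensor.incl k E U)| ≤ C) : ‖U‖ ≤ C := by
  have : Nonempty (Metric.closedBall (0 : StrongDual ℝ E) 1) := ⟨⟨0, by simp⟩⟩
  exact ciSup_le fun f => h f (mem_closedBall_zero_iff.mp f.2)

theorem SymAlgTensor.norm_le_norm_incl (U : SymAlgTensor k E) :
    ‖U‖ ≤ ‖SymAlgTensor.incl k E U‖ :=
  SymAlgTensor.norm_le fun f hf => AlgTensor.abs_eval_le_norm (fun _ => f) (fun _ => hf) _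

theorem AlgTensor.norm_pure_le (x : Fin k → E) : ‖AlgTensor.pure x‖ ≤ ∏ n, ‖x n‖ := by
  have : Nonempty (DualBallTuple k E) := ⟨fun _ => ⟨0, by simp⟩⟩
  refine ciSup_le fun f => ?_
  rw [AlgTensor.eval_pure, Finset.abs_prod]
  refine Finset.prod_le_prod (fun _ _ => abs_nonneg _) fun n _ => ?_
  exact ((f n : StrongDual ℝ E).le_opNorm (x n)).trans
    (mul_le_of_le_one_left (norm_nonneg _) (mem_closedBall_zero_iff.mp (f n).2))

variable (k E) in
/-- The canonical multilinear map into the algebraic tensor power. -/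
noncomputable def AlgTensor.pureMultilinear :
    MultilinearMap ℝ (fun _ : Fin k => E) (AlgTensor k E) where
  toFun := AlgTensor.pure
  map_update_add' x i a b := (PiTensorProduct.tprod ℝ).map_update_add x i a b
  map_update_smul' x i c a := (PiTensorProduct.tprod ℝ).map_update_smul x i c a

theorem AlgTensor.continuous_pure : Continuous (AlgTensor.pure : (Fin k → E) → AlgTensor k E) :=
  ((AlgTensor.pureMultilinear k E).mkContinuous 1 fun x => by
    rw [one_mul]; exact AlgTensor.norm_pure_le x).cont

theorem continuous_tensorPow : Continuous (tensorPow k : E → InjTensor k E) :=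
  (UniformSpace.Completion.continuous_coe _).comp
    (AlgTensor.continuous_pure.comp (continuous_pi fun _ => continuous_id))

theorem norm_tensorPow_le (x : E) : ‖tensorPow k x‖ ≤ ‖x‖ ^ k := by
  rw [tensorPow, UniformSpace.Completion.norm_coe]
  simpa using AlgTensor.norm_pure_le fun _ : Fin k => x

theorem incl_algSymTensorPow (x : E) :
    SymAlgTensor.incl k E (algSymTensorPow k x) = AlgTensor.pure fun _ => x := rfl

theorem eval_algSymTensorPow (f : StrongDual ℝ E) (x : E) :
    AlgTensor.eval (fun _ => f) (SymAlgTensor.incl k E (algSymTensorPow k x)) = f x ^ k := by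
  rw [incl_algSymTensorPow, AlgTensor.eval_pure]
  simp

theorem continuous_algSymTensorPow : Continuous (algSymTensorPow k : E → SymAlgTensor k E) := by
  rw [continuous_iff_continuousAt]
  intro x
  have h : Continuous fun y : E => (AlgTensor.pure fun _ => y : AlgTensor k E) :=
    AlgTensor.continuous_pure.comp (continuous_pi fun _ => continuous_id)
  refine tendsto_iff_norm_sub_tendsto_zero.mpr ?_
  refine squeeze_zero (fun _ => norm_nonneg _) (fun y => ?_)
    (tendsto_iff_norm_sub_tendsto_zero.mp (h.tendsto x))
  refine (SymAlgTensor.norm_le_norm_incl _).trans (le_of_eq ?_)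
  rw [map_sub, incl_algSymTensorPow, incl_algSymTensorPow]

theorem continuous_symTensorPow : Continuous (symTensorPow k : E → SymInjTensor k E) :=
  (UniformSpace.Completion.continuous_coe _).comp continuous_algSymTensorPow

theorem norm_symTensorPow_le (x : E) : ‖symTensorPow k x‖ ≤ ‖x‖ ^ k := by
  rw [symTensorPow, UniformSpace.Completion.norm_coe]
  refine (SymAlgTensor.norm_le_norm_incl _).trans ?_
  simpa [incl_algSymTensorPow] using AlgTensor.norm_pure_le fun _ : Fin k => x

/-! ### Powers of functionals on the completed tensor products -/

theorem exists_injTensor_functional (f : StrongDual ℝ E) (hf : ‖f‖ ≤ 1) :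
    ∃ Λ : InjTensor k E →L[ℝ] ℝ, ∀ x, Λ (tensorPow k x) = f x ^ k := by
  let l : AlgTensor k E →L[ℝ] ℝ := (AlgTensor.eval fun _ => f).mkContinuous 1 fun U => by
    rw [one_mul]; exact AlgTensor.abs_eval_le_norm _ (fun _ => hf) U
  refine ⟨l.extend UniformSpace.Completion.toComplL, fun x => ?_⟩
  refine (l.extend_eq UniformSpace.Completion.denseRange_coe
    (UniformSpace.Completion.isUniformInducing_coe _) _).trans ?_
  exact (AlgTensor.eval_pure _ _).trans (by simp)

theorem exists_symInjTensor_functional (f : StrongDual ℝ E) (hf : ‖f‖ ≤ 1) :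
    ∃ Λ : SymInjTensor k E →L[ℝ] ℝ, ∀ U : SymAlgTensor k E,
      Λ U = AlgTensor.eval (fun _ => f) (SymAlgTensor.incl k E U) := by
  let l : SymAlgTensor k E →L[ℝ] ℝ :=
    ((AlgTensor.eval fun _ => f) ∘ₗ SymAlgTensor.incl k E).mkContinuous 1 fun U => by
      rw [one_mul]; exact SymAlgTensor.abs_eval_le_norm _ hf U
  exact ⟨l.extend UniformSpace.Completion.toComplL, l.extend_eq
    UniformSpace.Completion.denseRange_coe (UniformSpace.Completion.isUniformInducing_coe _)⟩

theorem abs_symInjTensor_functional_le {f : StrongDual ℝ E} (hf : ‖f‖ ≤ 1)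
    {Λ : SymInjTensor k E →L[ℝ] ℝ} (hΛ : ∀ U : SymAlgTensor k E,
      Λ U = AlgTensor.eval (fun _ => f) (SymAlgTensor.incl k E U)) (z : SymInjTensor k E) :
    |Λ z| ≤ ‖z‖ := by
  induction z using UniformSpace.Completion.induction_on with
  | hp => exact isClosed_le (by fun_prop) (by fun_prop)
  | ih U =>
    rw [hΛ, UniformSpace.Completion.norm_coe]
    exact SymAlgTensor.abs_eval_le_norm f hf U

/-- The powers of functionals in the unit ball separate the points of the symmetric injective
tensor product. -/
theorem SymInjTensor.eq_zero_of_forall_functional (z : SymInjTensor k E)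
    (h : ∀ f : StrongDual ℝ E, ‖f‖ ≤ 1 → ∀ Λ : SymInjTensor k E →L[ℝ] ℝ,
      (∀ U : SymAlgTensor k E, Λ U = AlgTensor.eval (fun _ => f) (SymAlgTensor.incl k E U)) →
      Λ z = 0) : z = 0 := by
  by_contra hz
  have hz : 0 < ‖z‖ := norm_pos_iff.mpr hz
  obtain ⟨_, ⟨U, rfl⟩, hU⟩ := Metric.mem_closure_iff.mp
    (UniformSpace.Completion.denseRange_coe z) (‖z‖ / 2) (by positivity)
  rw [dist_comm, dist_eq_norm] at hU
  -- Every such functional vanishes at `z`, so its value at `U` is its value at `U - z`. The norm of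
  -- `U` is the supremum of these values.
  have h1 : ‖U‖ ≤ ‖(U : SymInjTensor k E) - z‖ := by
    refine SymAlgTensor.norm_le fun f hf => ?_
    obtain ⟨Λ, hΛ⟩ := exists_symInjTensor_functional (k := k) f hf
    have := abs_symInjTensor_functional_le hf hΛ ((U : SymInjTensor k E) - z)
    rwa [map_sub, h f hf Λ hΛ, sub_zero, hΛ] at this
  have h2 : ‖z‖ ≤ ‖(U : SymInjTensor k E)‖ + ‖(U : SymInjTensor k E) - z‖ := by
    have := norm_sub_le (U : SymInjTensor k E) ((U : SymInjTensor k E) - z)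
    rwa [sub_sub_cancel] at this
  rw [UniformSpace.Completion.norm_coe] at h2
  linarith

variable {Ω : Type v} [MeasurableSpace Ω] {P : Measure Ω}

/-- If the injective moment of `ξ` vanishes, so does the expectation of `⊗^k ξ` in the symmetric
injective tensor product. -/
theorem integral_symTensorPow_eq_zero {ξ : Ω → E} (hξ : AEStronglyMeasurable ξ P)
    (hint : Integrable (fun ω => ‖ξ ω‖ ^ k) P) (h : injMoment k P ξ = 0) :
    ∫ ω, symTensorPow k (ξ ω) ∂P = 0 := by
  have i1 : Integrable (fun ω => tensorPow k (ξ ω)) P :=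
    hint.mono' (continuous_tensorPow.comp_aestronglyMeasurable hξ)
      (Filter.Eventually.of_forall fun ω => norm_tensorPow_le _)
  have i2 : Integrable (fun ω => symTensorPow k (ξ ω)) P :=
    hint.mono' (continuous_symTensorPow.comp_aestronglyMeasurable hξ)
      (Filter.Eventually.of_forall fun ω => norm_symTensorPow_le _)
  refine SymInjTensor.eq_zero_of_forall_functional _ fun f hf Λ hΛ => ?_
  -- `Λ` and `Λ'` both send the `k`th power of `ξ` to `f(ξ)^k`, so no map between the two
  -- completions is needed.
  obtain ⟨Λ', hΛ'⟩ := exists_injTensor_functional (k := k) f hf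
  rw [← Λ.integral_comp_comm i2]
  have h1 := Λ'.integral_comp_comm i1
  change _ = Λ' (injMoment k P ξ) at h1
  rw [h, map_zero] at h1
  rw [← h1]
  refine integral_congr_ae (Filter.Eventually.of_forall fun ω => ?_)
  change Λ (symTensorPow k (ξ ω)) = Λ' (tensorPow k (ξ ω))
  rw [hΛ', symTensorPow, hΛ, eval_algSymTensorPow]

/-! ### Sign averages of symmetric tensor powers -/

/-- The Lipschitz bound for `t ↦ t^k` on `[-c, c]`, in the form required by the contraction
principle. -/
theorem abs_pow_sub_pow_le_of_abs_le {a b c : ℝ} (ha : |a| ≤ c) (hb : |b| ≤ c) :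
    |a ^ k - b ^ k| ≤ |(k * c ^ (k - 1)) * a - (k * c ^ (k - 1)) * b| := by
  have hc : 0 ≤ c := (abs_nonneg _).trans ha
  rw [← mul_sub, abs_mul, abs_of_nonneg (by positivity : 0 ≤ k * c ^ (k - 1))]
  refine (abs_pow_sub_pow_le a b k).trans ?_
  rw [mul_comm, mul_comm (|a - b|), ← mul_assoc, mul_comm _ (k : ℝ)]
  gcongr
  exact max_le ha hb

/-- The contraction principle over the dual ball, comparing `f(x_j)^k` with `k‖x_j‖^(k-1) f(x_j)`.
-/
theorem signMean_norm_algSymTensorPow_le (hk : 1 ≤ k) {p : ℝ} (hp : 1 ≤ p) {n : ℕ} (x : Fin n → E) :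
    signMean (fun ε => ‖∑ j, ε j • algSymTensorPow k (x j)‖ ^ p) ≤
      (2 * k) ^ p * signMean (fun ε => ‖∑ j, ε j • (‖x j‖ ^ (k - 1) • x j)‖ ^ p) := by
  have hp0 : 0 ≤ p := by linarith
  -- The positive part makes the power `p` monotone and convex on the whole line, as the one-sided
  -- contraction principle demands.
  let G : ℝ → ℝ := fun t => max t 0 ^ p
  have hG : Monotone G := fun a b hab =>
    Real.rpow_le_rpow (le_max_right _ _) (max_le_max_right 0 hab) hp0
  have hcont : Continuous G := by
    refine Continuous.rpow_const (by fun_prop) fun _ => Or.inr hp0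
  have hconv : ConvexOn ℝ Set.univ G := by
    have h1 : ConvexOn ℝ Set.univ fun t : ℝ => max t 0 :=
      (convexOn_id convex_univ).sup (convexOn_const 0 convex_univ)
    refine ⟨convex_univ, fun a _ b _ s t hs ht hst => ?_⟩
    refine (Real.rpow_le_rpow (le_max_right _ _) (h1.2 (Set.mem_univ a) (Set.mem_univ b) hs ht hst)
      hp0).trans ?_
    exact (convexOn_rpow hp).2 (le_max_right a 0) (le_max_right b 0) hs ht hst
  let ι := Metric.closedBall (0 : StrongDual ℝ E) 1
  have hι : Nonempty ι := ⟨⟨0, Metric.mem_closedBall_self zero_le_one⟩⟩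
  have hf : ∀ (f : ι) (y : E), |(f : StrongDual ℝ E) y| ≤ ‖y‖ := fun f y =>
    ((f : StrongDual ℝ E).le_opNorm y).trans
      (mul_le_of_le_one_left (norm_nonneg _) (mem_closedBall_zero_iff.mp f.2))
  let w : Fin n → ι → ℝ := fun j f => (f : StrongDual ℝ E) (x j) ^ k
  let t : Fin n → ι → ℝ := fun j f => (k * ‖x j‖ ^ (k - 1)) * (f : StrongDual ℝ E) (x j)
  have hw : ∀ j f f', |w j f - w j f'| ≤ |t j f - t j f'| := fun j f f' =>
    abs_pow_sub_pow_le_of_abs_le (hf f _) (hf f' _)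
  have hw0 : ∀ j f, |w j f| ≤ |t j f| := fun j f => by
    have := abs_pow_sub_pow_le_of_abs_le (k := k) (b := 0) (hf f (x j)) (by rw [abs_zero]; exact norm_nonneg _)
    rwa [zero_pow (by omega), mul_zero, sub_zero, sub_zero] at this
  have ht : ∀ j f, |t j f| ≤ ∑ j, (k * ‖x j‖ ^ (k - 1)) * ‖x j‖ := fun j f => by
    refine le_trans ?_ (Finset.single_le_sum
      (f := fun j => (k * ‖x j‖ ^ (k - 1)) * ‖x j‖) (fun j _ => by positivity) (Finset.mem_univ j))
    rw [abs_mul, abs_of_nonneg (by positivity : 0 ≤ k * ‖x j‖ ^ (k - 1))]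
    gcongr
    exact hf f _
  have hctr := signMean_iSup_contraction hG hcont hconv (h := fun _ : ι => (0 : ℝ)) (C := 0)
    (fun _ => by simp) ht hw0 hw
  simp only [zero_add] at hctr
  have heval : ∀ (ε : Fin n → ℝ) (f : StrongDual ℝ E),
      AlgTensor.eval (fun _ => f) (SymAlgTensor.incl k E (∑ j, ε j • algSymTensorPow k (x j))) =
        ∑ j, ε j * f (x j) ^ k := by
    intro ε f
    simp [map_sum, eval_algSymTensorPow]
  have hbdd : ∀ ε : Fin n → ℝ, BddAbove (Set.range fun f => ∑ j, ε j * w j f) := by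
    intro ε
    refine ⟨‖∑ j, ε j • algSymTensorPow k (x j)‖, ?_⟩
    rintro _ ⟨f, rfl⟩
    change ∑ j, ε j * (f : StrongDual ℝ E) (x j) ^ k ≤ _
    rw [← heval]
    exact (le_abs_self _).trans
      (SymAlgTensor.abs_eval_le_norm _ (mem_closedBall_zero_iff.mp f.2) _)
  -- The absolute value splits into the one-sided suprema for `ε` and `-ε`. These have the same sign
  -- average, which costs a factor 2, later enlarged to `2^p`.
  have hleft : ∀ ε : Fin n → ℝ, ‖∑ j, ε j • algSymTensorPow k (x j)‖ ^ p ≤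
      G (⨆ f, ∑ j, ε j * w j f) + G (⨆ f, ∑ j, (-ε) j * w j f) := by
    intro ε
    have hG0 : ∀ s, 0 ≤ G s := fun s => Real.rpow_nonneg (le_max_right _ _) _
    set N := max (max (⨆ f, ∑ j, ε j * w j f) 0) (max (⨆ f, ∑ j, (-ε) j * w j f) 0) with hN
    have h1 : ‖∑ j, ε j • algSymTensorPow k (x j)‖ ≤ N := by
      refine SymAlgTensor.norm_le fun f hf1 => ?_
      rw [heval]
      have a1 := le_ciSup (hbdd ε) ⟨f, mem_closedBall_zero_iff.mpr hf1⟩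
      have a2 := le_ciSup (hbdd (-ε)) ⟨f, mem_closedBall_zero_iff.mpr hf1⟩
      refine abs_le'.mpr ⟨?_, ?_⟩
      · exact a1.trans ((le_max_left _ _).trans (le_max_left _ _))
      · refine le_trans ?_ (a2.trans ((le_max_left _ _).trans (le_max_right _ _)))
        simp [w]
    refine (Real.rpow_le_rpow (norm_nonneg _) h1 hp0).trans ?_
    rcases max_choice (max (⨆ f, ∑ j, ε j * w j f) 0) (max (⨆ f, ∑ j, (-ε) j * w j f) 0)
      with h | h
    · rw [hN, h]; exact le_add_of_nonneg_right (hG0 _)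
    · rw [hN, h]; exact le_add_of_nonneg_left (hG0 _)
  have hright : ∀ ε : Fin n → ℝ, G (⨆ f, ∑ j, ε j * t j f) ≤
      (k : ℝ) ^ p * ‖∑ j, ε j • (‖x j‖ ^ (k - 1) • x j)‖ ^ p := by
    intro ε
    rw [← Real.mul_rpow (by positivity) (norm_nonneg _)]
    refine Real.rpow_le_rpow (le_max_right _ _) (max_le (ciSup_le fun f => ?_) (by positivity)) hp0
    have : ∑ j, ε j * t j f = k * (f : StrongDual ℝ E) (∑ j, ε j • (‖x j‖ ^ (k - 1) • x j)) := by
      simp only [map_sum, map_smul, smul_eq_mul, Finset.mul_sum, t]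
      exact Finset.sum_congr rfl fun j _ => by ring
    rw [this]
    gcongr
    exact (le_abs_self _).trans (hf f _)
  calc signMean (fun ε => ‖∑ j, ε j • algSymTensorPow k (x j)‖ ^ p)
      ≤ signMean (fun ε => G (⨆ f, ∑ j, ε j * w j f) + G (⨆ f, ∑ j, (-ε) j * w j f)) :=
        signMean_mono fun ε _ => hleft ε
    _ = 2 * signMean (fun ε => G (⨆ f, ∑ j, ε j * w j f)) := by
        rw [signMean_add, signMean_neg fun ε => G (⨆ f, ∑ j, ε j * w j f), two_mul]
    _ ≤ 2 * ((k : ℝ) ^ p * signMean (fun ε => ‖∑ j, ε j • (‖x j‖ ^ (k - 1) • x j)‖ ^ p)) := by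
        refine mul_le_mul_of_nonneg_left ?_ two_pos.le
        rw [← signMean_const_mul]
        exact hctr.trans (signMean_mono fun ε _ => hright ε)
    _ ≤ _ := by
        rw [← mul_assoc, Real.mul_rpow two_pos.le (by positivity)]
        have h0 : 0 ≤ signMean (fun ε => ‖∑ j, ε j • (‖x j‖ ^ (k - 1) • x j)‖ ^ p) :=
          signMean_nonneg fun _ => by positivity
        gcongr
        exact Real.self_le_rpow_of_one_le one_le_two hp

end Tensor

end InjectiveMoments

namespace InjectiveMoments

/-! ### Symmetrization -/

section Symmetrization

variable {Ω : Type v} {F : Type*} [NormedAddCommGroup F] [NormedSpace ℝ F]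

theorem lpNorm_congr_ae {G : Type*} [NormedAddCommGroup G] [MeasurableSpace Ω] {P : Measure Ω}
    {f g : Ω → G} (h : f =ᵐ[P] g) (s : ℝ≥0∞) : lpNorm f s P = lpNorm g s P := by
  by_cases hf : AEStronglyMeasurable f P
  · rw [← toReal_eLpNorm hf, ← toReal_eLpNorm (hf.congr h), eLpNorm_congr_ae h]
  · rw [lpNorm_of_not_aestronglyMeasurable hf,
      lpNorm_of_not_aestronglyMeasurable fun hg => hf (hg.congr h.symm)]

theorem lpNorm_ofReal_eq {G : Type*} [NormedAddCommGroup G] [MeasurableSpace Ω] {P : Measure Ω}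
    {f : Ω → G} {s : ℝ} (hs : 0 < s) (hf : AEStronglyMeasurable f P) :
    lpNorm f (ENNReal.ofReal s) P = (∫ ω, ‖f ω‖ ^ s ∂P) ^ (1 / s) := by
  rw [lpNorm_eq_integral_norm_rpow_toReal (by simpa using hs) ENNReal.ofReal_ne_top hf,
    ENNReal.toReal_ofReal hs.le, one_div]

theorem lpNorm_ofReal_rpow_eq {G : Type*} [NormedAddCommGroup G] [MeasurableSpace Ω] {P : Measure Ω}
    {f : Ω → G} {s : ℝ} (hs : 0 < s) (hf : AEStronglyMeasurable f P) :
    lpNorm f (ENNReal.ofReal s) P ^ s = ∫ ω, ‖f ω‖ ^ s ∂P := by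
  rw [lpNorm_ofReal_eq hs hf, one_div, Real.rpow_inv_rpow
    (integral_nonneg fun _ => by positivity) hs.ne']

variable [CompleteSpace F]

/-- Adding an independent centred random variable does not decrease the `L_q` norm. -/
theorem lpNorm_le_lpNorm_add_of_indep {m₁ m₂ m : MeasurableSpace Ω} {P : Measure[m] Ω}
    [IsProbabilityMeasure P] (h₁ : m₁ ≤ m) (h₂ : m₂ ≤ m) (hind : Indep m₁ m₂ P) {X Z : Ω → F}
    (hX : StronglyMeasurable[m₁] X) (hZ : StronglyMeasurable[m₂] Z) {q : ℝ} (hq : 1 ≤ q)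
    (hXq : MemLp X (ENNReal.ofReal q) P) (hZq : MemLp Z (ENNReal.ofReal q) P)
    (hZ0 : ∫ ω, Z ω ∂P = 0) :
    lpNorm X (ENNReal.ofReal q) P ≤ lpNorm (X + Z) (ENNReal.ofReal q) P := by
  have hq0 : 0 < q := by linarith
  have hq1 : (1 : ℝ≥0∞) ≤ ENNReal.ofReal q := by simpa using hq
  -- Conditioning on `m₁` averages `Z` out and recovers `X`; conditional Jensen then compares the
  -- `q`th moments.
  have hc : P[X + Z | m₁] =ᵐ[P] X := by
    have e1 := condExp_add (hXq.integrable hq1) (hZq.integrable hq1) m₁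
    have e2 := condExp_indep_eq h₂ h₁ hZ hind.symm
    have e3 : P[X | m₁] = X := condExp_of_stronglyMeasurable h₁ hX (hXq.integrable hq1)
    filter_upwards [e1, e2] with ω e1 e2
    rw [e1, Pi.add_apply, e2, e3, hZ0, add_zero]
  have hint : Integrable (fun ω => ‖(X + Z) ω‖ ^ q) P := by
    have := (hXq.add hZq).integrable_norm_rpow (by simpa using hq0) ENNReal.ofReal_ne_top
    rwa [ENNReal.toReal_ofReal hq0.le] at this
  have h := integral_norm_condExp_rpow_le (m := m₁) hq hint
  rw [integral_congr_ae (hc.mono fun ω hω => by simp only [hω] :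
    (fun ω => ‖(P[X + Z | m₁]) ω‖ ^ q) =ᵐ[P] fun ω => ‖X ω‖ ^ q)] at h
  rw [lpNorm_ofReal_eq hq0 hXq.1, lpNorm_ofReal_eq hq0 (hXq.add hZq).1]
  exact Real.rpow_le_rpow (integral_nonneg fun _ => by positivity) h (by positivity)

/-- Symmetrization: the `L_q` norm of a sum of independent centred random variables is at most
twice that of any signed sum. -/
theorem lpNorm_sum_le_two_mul_lpNorm_signed_sum {mΩ : MeasurableSpace Ω} {P : Measure Ω}
    [IsProbabilityMeasure P] {n : ℕ} {m : Fin n → MeasurableSpace Ω} (hm : ∀ j, m j ≤ mΩ)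
    (hind : iIndep m P) {Y : Fin n → Ω → F} (hY : ∀ j, StronglyMeasurable[m j] (Y j))
    {q : ℝ} (hq : 1 ≤ q) (hYq : ∀ j, MemLp (Y j) (ENNReal.ofReal q) P)
    (hY0 : ∀ j, ∫ ω, Y j ω ∂P = 0) {ε : Fin n → ℝ} (hε : ∀ j, |ε j| = 1) :
    lpNorm (fun ω => ∑ j, Y j ω) (ENNReal.ofReal q) P ≤
      2 * lpNorm (fun ω => ∑ j, ε j • Y j ω) (ENNReal.ofReal q) P := by
  have hq1 : (1 : ℝ≥0∞) ≤ ENNReal.ofReal q := by simpa using hq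
  have hsum : ∀ S : Finset (Fin n), MemLp (∑ j ∈ S, Y j) (ENNReal.ofReal q) P := fun S =>
    memLp_finsetSum' _ fun j _ => hYq j
  have hmeas : ∀ S : Finset (Fin n), StronglyMeasurable[⨆ j ∈ (S : Set (Fin n)), m j] (∑ j ∈ S, Y j) :=
    fun S => Finset.stronglyMeasurable_sum S fun j hj =>
      (hY j).mono (le_iSup₂_of_le (f := fun j (_ : j ∈ (S : Set (Fin n))) => m j) j hj le_rfl)
  -- The sum over the positive signs and the sum over the negative signs are each dominated by their
  -- difference, which is the signed sum. The triangle inequality then gives the factor 2, without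
  -- an independent copy.
  have key : ∀ S T : Finset (Fin n), Disjoint S T →
      lpNorm (∑ j ∈ S, Y j) (ENNReal.ofReal q) P ≤
        lpNorm (∑ j ∈ S, Y j + -∑ j ∈ T, Y j) (ENNReal.ofReal q) P := by
    intro S T hST
    refine lpNorm_le_lpNorm_add_of_indep (iSup₂_le fun j _ => hm j) (iSup₂_le fun j _ => hm j)
      (indep_iSup_of_disjoint hm hind (Finset.disjoint_coe.mpr hST)) (hmeas S) (hmeas T).neg hq
      (hsum S) (hsum T).neg ?_
    simp only [Pi.neg_apply, Finset.sum_apply]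
    rw [integral_neg, integral_finsetSum _ fun j _ => (hYq j).integrable hq1,
      Finset.sum_eq_zero fun j _ => hY0 j, neg_zero]
  set S : Finset (Fin n) := Finset.univ.filter fun j => ε j = 1 with hS
  set T : Finset (Fin n) := Finset.univ.filter fun j => ¬ ε j = 1 with hT
  have hST : Disjoint S T := Finset.disjoint_filter_filter_not _ _ _
  have e1 : (fun ω => ∑ j, Y j ω) = ∑ j ∈ S, Y j + ∑ j ∈ T, Y j := by
    rw [Finset.sum_filter_add_sum_filter_not]
    ext ω
    simp
  have e2 : (fun ω => ∑ j, ε j • Y j ω) = ∑ j ∈ S, Y j + -∑ j ∈ T, Y j := by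
    have h1 : ∑ j ∈ S, Y j = ∑ j ∈ S, ε j • Y j := Finset.sum_congr rfl fun j hj => by
      rw [(Finset.mem_filter.mp hj).2, one_smul]
    have h2 : -∑ j ∈ T, Y j = ∑ j ∈ T, ε j • Y j := by
      rw [← Finset.sum_neg_distrib]
      refine Finset.sum_congr rfl fun j hj => ?_
      have : ε j = -1 := (eq_or_eq_neg_of_abs_eq (hε j)).resolve_left (Finset.mem_filter.mp hj).2
      rw [this, neg_one_smul]
    rw [h1, h2, Finset.sum_filter_add_sum_filter_not]
    ext ω
    simp
  rw [e1, e2, two_mul]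
  refine (lpNorm_add_le (hsum S) hq1).trans (add_le_add (key S T hST) ?_)
  refine (key T S hST.symm).trans (le_of_eq ?_)
  rw [← lpNorm_neg]
  congr 1
  abel

end Symmetrization

/-! ### The moment inequality -/

/-- Transfers a bound from all admissible constants to their infimum. -/
theorem le_sInf_mul {S : Set ℝ} (hS : S.Nonempty) {a b : ℝ} (hb : 0 ≤ b)
    (h : ∀ t ∈ S, a ≤ t * b) : a ≤ sInf S * b := by
  rcases hb.eq_or_lt with rfl | hb
  · obtain ⟨t, ht⟩ := hS
    simpa using h t ht
  · rw [← div_le_iff₀ hb]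
    exact le_csInf hS fun t ht => (div_le_iff₀ hb).mpr (h t ht)

theorem kahaneKhintchineConst_nonneg (q p : ℝ) : 0 ≤ kahaneKhintchineConst.{u} q p :=
  Real.sInf_nonneg fun _ h => h.1.le

theorem typeConst_nonneg (F : Type u) [NormedAddCommGroup F] [NormedSpace ℝ F] (p : ℝ) :
    0 ≤ typeConst F p :=
  Real.sInf_nonneg fun _ h => h.1.le

/-- Minkowski's inequality in `L_{q/p}`, where `q/p ≥ 1`, for the functions `‖η_j‖^(kp)`. -/
theorem integral_rpow_sum_norm_le {E : Type*} [NormedAddCommGroup E] {Ω : Type*} [MeasurableSpace Ω]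
    {P : Measure Ω} {p q : ℝ} (hp : 1 ≤ p) (hpq : p ≤ q) {k M : ℕ} (hk : 1 ≤ k)
    {η : Fin M → Ω → E} (hη : ∀ j, MemLp (η j) (ENNReal.ofReal (k * q)) P) :
    Integrable (fun ω => (∑ j, ‖η j ω‖ ^ (k * p)) ^ (q / p)) P ∧
    ∫ ω, (∑ j, ‖η j ω‖ ^ (k * p)) ^ (q / p) ∂P ≤
      (∑ j, lpNorm (η j) (ENNReal.ofReal (k * q)) P ^ (k * p)) ^ (q / p) := by
  have hp0 : 0 < p := by linarith
  have hq0 : 0 < q := by linarith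
  have hk0 : (0 : ℝ) < k := by exact_mod_cast hk
  have hs0 : 0 < q / p := by positivity
  have hs1 : (1 : ℝ≥0∞) ≤ ENNReal.ofReal (q / p) := by
    simpa using (one_le_div hp0).mpr hpq
  let g : Fin M → Ω → ℝ := fun j ω => ‖η j ω‖ ^ (k * p)
  have hg : ∀ j, MemLp (g j) (ENNReal.ofReal (q / p)) P := by
    intro j
    have := (hη j).norm_rpow_div (ENNReal.ofReal (k * p))
    rw [ENNReal.toReal_ofReal (by positivity), ← ENNReal.ofReal_div_of_pos (by positivity),
      mul_div_mul_left _ _ hk0.ne'] at this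
    exact this
  have hgs : MemLp (∑ j, g j) (ENNReal.ofReal (q / p)) P := memLp_finsetSum' _ fun j _ => hg j
  have hnorm : ∀ ω, ‖(∑ j, g j) ω‖ = ∑ j, ‖η j ω‖ ^ (k * p) := by
    intro ω
    rw [Finset.sum_apply, Real.norm_of_nonneg (Finset.sum_nonneg fun j _ => by positivity)]
  have hgj : ∀ j, lpNorm (g j) (ENNReal.ofReal (q / p)) P =
      lpNorm (η j) (ENNReal.ofReal (k * q)) P ^ (k * p) := by
    intro j
    rw [lpNorm_ofReal_eq hs0 (hg j).1, lpNorm_ofReal_eq (by positivity) (hη j).1,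
      ← Real.rpow_mul (integral_nonneg fun _ => by positivity)]
    have e : ∀ ω, ‖g j ω‖ ^ (q / p) = ‖η j ω‖ ^ (k * q) := by
      intro ω
      rw [Real.norm_of_nonneg (by positivity), ← Real.rpow_mul (norm_nonneg _)]
      congr 1
      field_simp
    simp only [e]
    congr 1
    field_simp
  constructor
  · have := hgs.integrable_norm_rpow (by simpa using hs0) ENNReal.ofReal_ne_top
    rw [ENNReal.toReal_ofReal hs0.le] at this
    simpa only [hnorm] using this
  · have h1 := lpNorm_ofReal_rpow_eq hs0 hgs.1
    simp only [hnorm] at h1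
    rw [← h1]
    refine Real.rpow_le_rpow lpNorm_nonneg ?_ hs0.le
    refine (lpNorm_sum_le (fun j _ => hg j) hs1).trans (le_of_eq ?_)
    exact Finset.sum_congr rfl fun j _ => hgj j

section Main

variable {E : Type u} [NormedAddCommGroup E] [NormedSpace ℝ E]

/-- The deterministic core: Kahane–Khintchine in the completed symmetric power, then contraction,
then type `p` in `E`. -/
theorem signMean_norm_symTensorPow_le {p q : ℝ} (hp : HasRademacherType E p) (hpq : p ≤ q)
    {k M : ℕ} (hk : 1 ≤ k) (x : Fin M → E) :
    signMean (fun ε => ‖∑ j, ε j • symTensorPow k (x j)‖ ^ q) ≤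
      (2 * k * kahaneKhintchineConst.{u} q p * typeConst E p) ^ q *
        (∑ j, ‖x j‖ ^ (k * p)) ^ (q / p) := by
  obtain ⟨⟨hp1, -⟩, hτ⟩ := hp
  have hp0 : 0 < p := by linarith
  have hq0 : 0 < q := by linarith
  obtain ⟨Ω, _, P, r, hr⟩ := exists_isRademacherFamily
  have hK := kahaneKhintchineConst_nonneg.{u} q p
  have hT := typeConst_nonneg E p
  have h1 : lpNorm (fun ω => ∑ j : Fin M, r j ω • symTensorPow k (x j)) (ENNReal.ofReal q) P ≤
      kahaneKhintchineConst.{u} q p *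
        lpNorm (fun ω => ∑ j : Fin M, r j ω • symTensorPow k (x j)) (ENNReal.ofReal p) P :=
    le_sInf_mul (exists_isKahaneKhintchineBound hp1) lpNorm_nonneg
      fun K hK => hK.2 Ω P r hr _ M _
  have h2 : lpNorm (fun ω => ∑ j : Fin M, r j ω • symTensorPow k (x j)) (ENNReal.ofReal p) P ≤
      2 * k * lpNorm (fun ω => ∑ j : Fin M, r j ω • (‖x j‖ ^ (k - 1) • x j)) (ENNReal.ofReal p) P := by
    rw [hr.lpNorm_sum _ hp0, hr.lpNorm_sum _ hp0]
    have e : ∀ ε : Fin M → ℝ, ‖∑ j, ε j • symTensorPow k (x j)‖ =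
        ‖∑ j, ε j • algSymTensorPow k (x j)‖ := by
      intro ε
      rw [← UniformSpace.Completion.norm_coe (∑ j, ε j • algSymTensorPow k (x j)),
        ← UniformSpace.Completion.coe_toComplL (𝕜 := ℝ),
        map_sum]
      simp only [map_smul]
      rfl
    simp only [e]
    refine (Real.rpow_le_rpow (signMean_nonneg fun _ => by positivity)
      (signMean_norm_algSymTensorPow_le hk hp1 x) (by positivity)).trans (le_of_eq ?_)
    rw [Real.mul_rpow (by positivity) (signMean_nonneg fun _ => by positivity), one_div,
      Real.rpow_rpow_inv (by positivity) hp0.ne']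
  have h3 : lpNorm (fun ω => ∑ j : Fin M, r j ω • (‖x j‖ ^ (k - 1) • x j)) (ENNReal.ofReal p) P ≤
      typeConst E p * (∑ j, ‖x j‖ ^ (k * p)) ^ (1 / p) := by
    -- The rescaled vector has norm `‖x_j‖^k`, which produces the exponent `kp`.
    have e : ∀ j, ‖x j‖ ^ (k * p) = ‖‖x j‖ ^ (k - 1) • x j‖ ^ p := by
      intro j
      rw [norm_smul, norm_pow, norm_norm, ← pow_succ, Nat.sub_add_cancel hk, Real.rpow_mul
        (norm_nonneg _), Real.rpow_natCast]
    simp only [e]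
    exact le_sInf_mul hτ (Real.rpow_nonneg (Finset.sum_nonneg fun _ _ => by positivity) _)
      fun τ hτ => hτ.2 Ω P r hr M _
  have h4 : lpNorm (fun ω => ∑ j : Fin M, r j ω • symTensorPow k (x j)) (ENNReal.ofReal q) P ≤
      (2 * k * kahaneKhintchineConst.{u} q p * typeConst E p) *
        (∑ j, ‖x j‖ ^ (k * p)) ^ (1 / p) := by
    calc _ ≤ _ := h1
      _ ≤ kahaneKhintchineConst.{u} q p *
          (2 * k * (typeConst E p * (∑ j, ‖x j‖ ^ (k * p)) ^ (1 / p))) := by gcongr; exact h2.trans (by gcongr)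
      _ = _ := by ring
  have hs : 0 ≤ ∑ j, ‖x j‖ ^ (k * p) := Finset.sum_nonneg fun _ _ => by positivity
  have h5 := Real.rpow_le_rpow lpNorm_nonneg h4 hq0.le
  rw [hr.lpNorm_sum _ hq0, one_div, Real.rpow_inv_rpow (signMean_nonneg fun _ => by positivity)
    hq0.ne', Real.mul_rpow (by positivity) (by positivity), ← Real.rpow_mul hs] at h5
  rwa [show q / p = 1 / p * q by ring]

variable {Ω : Type v} [MeasurableSpace Ω] {P : Measure Ω}

theorem memLp_symTensorPow {q : ℝ} {k : ℕ} (hk : 1 ≤ k) {ξ : Ω → E}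
    (hξ : MemLp ξ (ENNReal.ofReal (k * q)) P) :
    MemLp (fun ω => ‖ξ ω‖ ^ k) (ENNReal.ofReal q) P ∧
    MemLp (fun ω => symTensorPow k (ξ ω)) (ENNReal.ofReal q) P := by
  have hk0 : (0 : ℝ) < k := by exact_mod_cast hk
  have h1 : MemLp (fun ω => ‖ξ ω‖ ^ k) (ENNReal.ofReal q) P := by
    have := hξ.norm_rpow_div (ENNReal.ofReal k)
    rw [ENNReal.toReal_ofReal (by positivity), ← ENNReal.ofReal_div_of_pos (by positivity),
      mul_div_cancel_left₀ _ hk0.ne'] at this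
    simpa only [Real.rpow_natCast] using this
  refine ⟨h1, h1.mono' (continuous_symTensorPow.comp_aestronglyMeasurable hξ.1)
    (Filter.Eventually.of_forall fun ω => norm_symTensorPow_le _)⟩

variable [IsProbabilityMeasure P] [MeasurableSpace E] [BorelSpace E]

theorem lpNorm_sum_symTensorPow_le_of_stronglyMeasurable {p q : ℝ} (hp : HasRademacherType E p)
    (hpq : p ≤ q) {k M : ℕ} (hk : 1 ≤ k) {η : Fin M → Ω → E} (hηm : ∀ j, StronglyMeasurable (η j))
    (hη : ∀ j, MemLp (η j) (ENNReal.ofReal (k * q)) P) (hindep : iIndepFun η P)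
    (hmoment : ∀ j, injMoment k P (η j) = 0) :
    lpNorm (fun ω => ∑ j, symTensorPow k (η j ω)) (ENNReal.ofReal q) P ≤
      4 * k * kahaneKhintchineConst.{u} q p * typeConst E p *
        (∑ j, lpNorm (η j) (ENNReal.ofReal (k * q)) P ^ (k * p)) ^ (1 / p) := by
  have hp1 : 1 ≤ p := hp.1.1
  have hp0 : 0 < p := by linarith
  have hq1 : 1 ≤ q := hp1.trans hpq
  have hq0 : 0 < q := by linarith
  have hq1' : (1 : ℝ≥0∞) ≤ ENNReal.ofReal q := by simpa using hq1
  have hK := kahaneKhintchineConst_nonneg.{u} q p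
  have hT := typeConst_nonneg E p
  have hY : ∀ j, MemLp (fun ω => symTensorPow k (η j ω)) (ENNReal.ofReal q) P := fun j =>
    (memLp_symTensorPow hk (hη j)).2
  have hY0 : ∀ j, ∫ ω, symTensorPow k (η j ω) ∂P = 0 := fun j =>
    integral_symTensorPow_eq_zero (hη j).1
      ((memLp_symTensorPow hk (hη j)).1.integrable hq1') (hmoment j)
  -- Symmetrization needs strong measurability for the σ-algebra generated by `η_j`. As `E` may be
  -- nonseparable, this uses the separable range of `η_j`.
  have hYm : ∀ j, StronglyMeasurable[MeasurableSpace.comap (η j) inferInstance]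
      (fun ω => symTensorPow k (η j ω)) := fun j =>
    continuous_symTensorPow.comp_stronglyMeasurable
      (stronglyMeasurable_iff_measurable_separable.mpr
        ⟨comap_measurable (η j), (hηm j).isSeparable_range⟩)
  have hsgn : ∀ ε : Fin M → ℝ,
      MemLp (fun ω => ∑ j, ε j • symTensorPow k (η j ω)) (ENNReal.ofReal q) P := fun ε =>
    memLp_finsetSum _ fun j _ => (hY j).const_smul (ε j)
  have hsgn' : ∀ ε : Fin M → ℝ,
      Integrable (fun ω => ‖∑ j, ε j • symTensorPow k (η j ω)‖ ^ q) P := fun ε => by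
    have := (hsgn ε).integrable_norm_rpow (by simpa using hq0) ENNReal.ofReal_ne_top
    rwa [ENNReal.toReal_ofReal hq0.le] at this
  set N := lpNorm (fun ω => ∑ j, symTensorPow k (η j ω)) (ENNReal.ofReal q) P with hN
  set B := ∑ j, lpNorm (η j) (ENNReal.ofReal (k * q)) P ^ (k * p) with hB
  have hB0 : 0 ≤ B := Finset.sum_nonneg fun j _ => Real.rpow_nonneg lpNorm_nonneg _
  set C := 2 * k * kahaneKhintchineConst.{u} q p * typeConst E p with hC
  have hC0 : 0 ≤ C := by positivity
  have hsym : ∀ ε : Fin M → ℝ, (∀ j, |ε j| = 1) →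
      N ^ q ≤ 2 ^ q * ∫ ω, ‖∑ j, ε j • symTensorPow k (η j ω)‖ ^ q ∂P := by
    intro ε hε
    have h := lpNorm_sum_le_two_mul_lpNorm_signed_sum (fun j => (hηm j).measurable.comap_le)
      ((iIndepFun_iff_iIndep _ _ _).mp hindep) hYm hq1 hY hY0 hε
    rw [← lpNorm_ofReal_rpow_eq hq0 (hsgn ε).1, ← Real.mul_rpow two_pos.le lpNorm_nonneg]
    exact Real.rpow_le_rpow lpNorm_nonneg h hq0.le
  obtain ⟨hBi, hBle⟩ := integral_rpow_sum_norm_le hp1 hpq hk hη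
  -- The sign average is a finite sum, so linearity of the integral replaces Fubini.
  have hmean : signMean (fun ε : Fin M → ℝ => ∫ ω, ‖∑ j, ε j • symTensorPow k (η j ω)‖ ^ q ∂P) =
      ∫ ω, signMean (fun ε : Fin M → ℝ => ‖∑ j, ε j • symTensorPow k (η j ω)‖ ^ q) ∂P := by
    simp only [signMean]
    rw [integral_div, integral_finsetSum _ fun ε _ => hsgn' _]
  have main : N ^ q ≤ (2 * C * B ^ (1 / p)) ^ q := by
    calc N ^ q = signMean (fun _ : Fin M → ℝ => N ^ q) := (signMean_const _).symm
      _ ≤ signMean (fun ε : Fin M → ℝ =>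
          2 ^ q * ∫ ω, ‖∑ j, ε j • symTensorPow k (η j ω)‖ ^ q ∂P) := signMean_mono hsym
      _ = 2 ^ q * ∫ ω, signMean (fun ε : Fin M → ℝ =>
          ‖∑ j, ε j • symTensorPow k (η j ω)‖ ^ q) ∂P := by rw [signMean_const_mul, hmean]
      _ ≤ 2 ^ q * ∫ ω, C ^ q * (∑ j, ‖η j ω‖ ^ (k * p)) ^ (q / p) ∂P := by
          refine mul_le_mul_of_nonneg_left ?_ (by positivity)
          refine integral_mono_of_nonneg
            (Filter.Eventually.of_forall fun ω => signMean_nonneg fun _ => by positivity)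
            (hBi.const_mul _) (Filter.Eventually.of_forall fun ω => ?_)
          exact signMean_norm_symTensorPow_le hp hpq hk fun j => η j ω
      _ ≤ 2 ^ q * (C ^ q * B ^ (q / p)) := by
          rw [integral_const_mul]
          gcongr
      _ = (2 * C * B ^ (1 / p)) ^ q := by
          rw [Real.mul_rpow (mul_nonneg two_pos.le hC0) (by positivity), Real.mul_rpow two_pos.le hC0,
            ← Real.rpow_mul hB0, mul_assoc, show 1 / p * q = q / p by ring]
  refine ((Real.rpow_le_rpow_iff lpNorm_nonneg (by positivity) hq0).mp main).trans (le_of_eq ?_)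
  rw [hC]
  ring

end Main

end InjectiveMoments

/-- Passing to strongly measurable representatives preserves independence, moments and norms, so the
strongly measurable case suffices. -/
theorem mainTheorem11 {E : Type u} [NormedAddCommGroup E] [NormedSpace ℝ E] [CompleteSpace E]
    [MeasurableSpace E] [BorelSpace E]
    {Ω : Type v} [MeasurableSpace Ω] (P : Measure Ω) [IsProbabilityMeasure P]
    (p q : ℝ) (hp : InjectiveMoments.HasRademacherType E p) (hpq : p ≤ q)
    (k M : ℕ) (hk : 1 ≤ k) (η : Fin M → Ω → E)
    (hη : ∀ j, MemLp (η j) (ENNReal.ofReal (k * q)) P)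
    (hindep : iIndepFun η P)
    (hmoment : ∀ j, InjectiveMoments.injMoment k P (η j) = 0) :
    MemLp (fun ω => ∑ j, InjectiveMoments.symTensorPow k (η j ω)) (ENNReal.ofReal q) P ∧
    lpNorm (fun ω => ∑ j, InjectiveMoments.symTensorPow k (η j ω)) (ENNReal.ofReal q) P ≤
      4 * k * InjectiveMoments.kahaneKhintchineConst.{u} q p * InjectiveMoments.typeConst E p *
        (∑ j, lpNorm (η j) (ENNReal.ofReal (k * q)) P ^ (k * p)) ^ (1 / p) := by
  refine ⟨memLp_finsetSum _ fun j _ =>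
    (InjectiveMoments.memLp_symTensorPow hk (hη j)).2, ?_⟩
  have hae : ∀ j, η j =ᵐ[P] (hη j).1.mk (η j) := fun j => (hη j).1.ae_eq_mk
  have h := InjectiveMoments.lpNorm_sum_symTensorPow_le_of_stronglyMeasurable (P := P) hp hpq hk
    (η := fun j => (hη j).1.mk (η j)) (fun j => (hη j).1.stronglyMeasurable_mk)
    (fun j => (hη j).ae_eq (hae j)) (hindep.congr hae) fun j => by
      rw [← hmoment j]
      exact integral_congr_ae ((hae j).symm.fun_comp (InjectiveMoments.tensorPow k))
  have e : (fun ω => ∑ j, InjectiveMoments.symTensorPow k (η j ω)) =ᵐ[P]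
      fun ω => ∑ j, InjectiveMoments.symTensorPow k ((hη j).1.mk (η j) ω) := by
    filter_upwards [Filter.eventually_all.mpr hae] with ω hω
    exact Finset.sum_congr rfl fun j _ => by rw [hω j]
  rw [InjectiveMoments.lpNorm_congr_ae e]
  simpa only [InjectiveMoments.lpNorm_congr_ae (hae _)] using h
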